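/- **Model.** Let $1\le d<D$, $k\ge 2$, $\mathrm{rch}_{\min}>0$, $\mathbf L=(L_2,\dots,L_k)\in(0,\infty)^{k-1}$ and $0<f_{\min}\le f_{\max}<\infty$. For $K\subset\mathbb R^D$, let $\mathrm{d}_K(x,y)\in[0,\infty]$ be the infimum of the lengths of the continuous paths from $x$ to $y$ contained in $K$, let $K^{\varepsilon}=\{z:\mathrm{dist}(z,K)\le\varepsilon\}$ be its $\varepsilon$-offset, and let the reach $\mathrm{rch}(K)$ be the smallest distance from $K$ to its medial axis (the set of points that have at least two nearest points on $K$). Let $\mathcal C^k$ be the class of compact connected $d$-dimensional $C^k$-submanifolds $M\subset\mathbb R^D$ without boundary such that $\mathrm{rch}(M)\ge \mathrm{rch}_{\min}$ and such that for every $p\in M$ there is a one-to-one map $v\mapsto p+v+N_p(v)$ from the ball of radius $1/(4L_2)$ of $T_pM$ into $M$, with $N_p$ of class $C^k$, $N_p(0)=0$, $d_0N_p=0$ and $\|d^j_vN_p\|_{\mathrm{op}}\le L_j$ for all $v$ in this ball and $2\le j\le k$. Let $\mathcal P^k$ be the set of probability distributions $P$ on $\mathbb R^D$ whose support $M$ belongs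 to $\mathcal C^k$ and which have a density with values in $[f_{\min},f_{\max}]$ with respect to the $d$-dimensional volume measure of $M$. Put $$\mathrm d_{\max}:=\frac{4^d}{(1-1/8^2)^{d/2}\,\omega_d\,f_{\min}\,\mathrm{rch}_{\min}^{d-1}},$$ where $\omega_d$ is the volume of the unit ball of $\mathbb R^d$. For $P\in\mathcal P^k$ with support $M$ and a function $\mathrm d'$ of two points, let $\ell_\infty(\mathrm d'\mid \mathrm d_M)=\sup_{x\ne y\in M}|1-\mathrm d'(x,y)/\mathrm d_M(x,y)|$. **Theorem (plug-in metric learning upper bound).** 1. For every $P\in\mathcal P^k$ with support $M$, $\sup_{x,y\in M}\mathrm d_M(x,y)\le \mathrm d_{\max}$. 2. Let $\Delta\ge \mathrm d_{\max}$ (for instance $\Delta=\mathrm d_{\max}$), $n\ge 0$ and $\varepsilon_n>0$, and let $\widehat M=\widehat M(X_1,\dots,X_n)\subset\mathbb R^D$ be any set-valued estimator. Define $$\widehat{\mathrm d}(x,y):=\min\bigl(\mathrm d_{(\widehat M\cup\{x,y\})^{\varepsilon_n}}(x,y),\,\Delta\bigr).$$ Then, for every $P\in\mathcal P^k$ with support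 $M$, writing $\mathcal A_n=\{\mathrm d_{\mathrm H}(\widehat M,M)\le\varepsilon_n\}$ for the Hausdorff distance $\mathrm d_{\mathrm H}$, $$\mathbb E_{P^{\otimes n}}\bigl[\ell_\infty(\widehat{\mathrm d}\mid \mathrm d_M)\bigr]\le \frac{2\varepsilon_n}{\mathrm{rch}_{\min}}\,P^{\otimes n}(\mathcal A_n)+\Bigl(1+\frac{\Delta}{\varepsilon_n}\Bigr)P^{\otimes n}(\mathcal A_n^c).$$ (If $\widehat M$ is not measurable, expectation and probabilities are outer ones.) -/

import Mathlib

open MeasureTheory Set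
open scoped ENNReal MeasureTheory

noncomputable section

namespace MetricLearning

/-- The ambient Euclidean space `ℝ^D`. -/
abbrev Amb (D : ℕ) : Type := EuclideanSpace ℝ (Fin D)

section Geometry

variable {E : Type*} [NormedAddCommGroup E] [InnerProductSpace ℝ E]

/-- The intrinsic (shortest-path) distance of a set `K`: the infimum of the lengths of the
continuous paths inside `K` joining `x` to `y`, with value `∞` if there is no such path of finite
length. The length of a path is its total variation, i.e. the supremum over all subdivisions of
the lengths of the inscribed polygonal lines. -/
def geodesicDist (K : Set E) (x y : E) : ℝ≥0∞ :=
  ⨅ (γ : Path x y) (_ : ∀ t, γ t ∈ K), eVariationOn γ Set.univ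

/-- The medial axis of `K`: the points having at least two nearest points on `K`. -/
def medialAxis (K : Set E) : Set E :=
  {z | ∃ x ∈ K, ∃ y ∈ K, x ≠ y ∧
    edist z x = Metric.infEDist z K ∧ edist z y = Metric.infEDist z K}

/-- The reach of `K`: the smallest distance from `K` to its medial axis (`∞` if the medial axis is
empty). -/
def reach (K : Set E) : ℝ≥0∞ :=
  ⨅ z ∈ medialAxis K, Metric.infEDist z K

/-- `M` is a (boundaryless, embedded) `d`-dimensional submanifold of `E` of class `C^k`: around each
of its points, a `C^k`-diffeomorphism between open sets of `E` maps `M` onto a `d`-dimensional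
linear subspace. -/
def IsSubmanifoldOfClass (d k : ℕ) (M : Set E) : Prop :=
  ∀ p ∈ M, ∃ (φ : OpenPartialHomeomorph E E) (F : Submodule ℝ E),
    p ∈ φ.source ∧ Module.finrank ℝ F = d ∧
    ContDiffOn ℝ k φ φ.source ∧ ContDiffOn ℝ k φ.symm φ.target ∧
    φ.IsImage M (F : Set E)

/-- The tangent space `T_p M`, as a linear subspace of the ambient space: the linear span of all
limits of secant directions of `M` at `p`. -/
def tangentSpace (M : Set E) (p : E) : Submodule ℝ E :=
  Submodule.span ℝ (tangentConeAt ℝ M p)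

/-- The geometric model: compact connected `d`-dimensional `C^k`-submanifolds without boundary,
with reach at least `rmin`, such that around each point `p` there is a one-to-one parametrization
`v ↦ p + v + N v` defined on the ball of radius `1 / (4 L₂)` of `T_p M`, with `N` of class `C^k`,
`N 0 = 0`, `d₀N = 0` and derivatives of order `j ∈ {2, …, k}` bounded by `L j`. -/
structure IsModelManifold (d k : ℕ) (rmin : ℝ) (L : ℕ → ℝ) (M : Set E) : Prop where
  submanifold : IsSubmanifoldOfClass d k M
  isCompact : IsCompact M
  isConnected : IsConnected M
  le_reach : ENNReal.ofReal rmin ≤ reach M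
  parametrization : ∀ p ∈ M, ∃ N : tangentSpace M p → E,
    ContDiffOn ℝ k N (Metric.ball 0 (1 / (4 * L 2))) ∧
    N 0 = 0 ∧ fderiv ℝ N 0 = 0 ∧
    (∀ v ∈ Metric.ball (0 : tangentSpace M p) (1 / (4 * L 2)),
      ∀ j ∈ Finset.Icc 2 k, ‖iteratedFDeriv ℝ j N v‖ ≤ L j) ∧
    MapsTo (fun v : tangentSpace M p => p + v + N v) (Metric.ball 0 (1 / (4 * L 2))) M ∧
    InjOn (fun v : tangentSpace M p => p + v + N v) (Metric.ball 0 (1 / (4 * L 2)))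

end Geometry

/-- The statistical model: probability distributions `P` on `ℝ^D` whose support `M` belongs to the
geometric model and that have a density with values in `[fmin, fmax]` with respect to the
`d`-dimensional volume measure of `M`. -/
structure IsModelDistribution {D : ℕ} (d k : ℕ) (rmin : ℝ) (L : ℕ → ℝ) (fmin fmax : ℝ)
    (P : Measure (Amb D)) : Prop where
  isProbabilityMeasure : IsProbabilityMeasure P
  support : IsModelManifold d k rmin L P.support
  density : ∃ f : Amb D → ℝ≥0∞, Measurable f ∧
    (∀ x ∈ P.support, ENNReal.ofReal fmin ≤ f x ∧ f x ≤ ENNReal.ofReal fmax) ∧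
    P = ((μHE[d] : Measure (Amb D)).restrict P.support).withDensity f

/-- The volume of the unit ball of `ℝ^d`. -/
def unitBallVolume (d : ℕ) : ℝ :=
  (volume (Metric.ball (0 : EuclideanSpace ℝ (Fin d)) 1)).toReal

/-- The explicit diameter bound
`d_max = 4^d / ((1 - 1/8²)^{d/2} ω_d f_min rch_min^{d-1})`. -/
def dMax (d : ℕ) (rmin fmin : ℝ) : ℝ :=
  rmin * (4 ^ d / ((1 - 1 / 8 ^ 2 : ℝ) ^ ((d : ℝ) / 2) * unitBallVolume d * fmin * rmin ^ d))

/-- The plug-in distance estimator: the intrinsic distance between `x` and `y` in the closed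
`ε`-offset of `S ∪ {x, y}`, truncated at level `Δ`. -/
def plugInDist {D : ℕ} (S : Set (Amb D)) (ε Δ : ℝ) (x y : Amb D) : ℝ :=
  (min (geodesicDist (Metric.cthickening ε (S ∪ {x, y})) x y) (ENNReal.ofReal Δ)).toReal

/-- The loss `ℓ_∞(d' | d_M) = sup_{x ≠ y ∈ M} |1 - d'(x, y) / d_M(x, y)|`. -/
def lossInf {D : ℕ} (M : Set (Amb D)) (d' : Amb D → Amb D → ℝ) : ℝ≥0∞ :=
  ⨆ (x ∈ M) (y ∈ M) (_ : x ≠ y), ENNReal.ofReal |1 - d' x y / (geodesicDist M x y).toReal|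

/-- The outer expectation of a `[0, ∞]`-valued function. It is the usual expectation as soon as the
function is measurable, and is an upper bound of it for every notion of integral otherwise. -/
def outerExpectation {Ω : Type*} [MeasurableSpace Ω] (μ : Measure Ω) (f : Ω → ℝ≥0∞) : ℝ≥0∞ :=
  ⨅ (g : Ω → ℝ≥0∞) (_ : Measurable g) (_ : ∀ ω, f ω ≤ g ω), ∫⁻ ω, g ω ∂μ

theorem outerExpectation_eq_lintegral {Ω : Type*} [MeasurableSpace Ω] (μ : Measure Ω)
    {f : Ω → ℝ≥0∞} (hf : Measurable f) : outerExpectation μ f = ∫⁻ ω, f ω ∂μ :=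
  le_antisymm (iInf₂_le_of_le f hf (iInf_le_of_le (fun _ => le_rfl) le_rfl))
    (le_iInf₂ fun _ _ => le_iInf fun h => lintegral_mono h)

/-- The event `A_n` that the manifold estimator `Mhat` is `ε`-precise in Hausdorff distance. -/
def preciseEvent {D n : ℕ} (Mhat : (Fin n → Amb D) → Set (Amb D)) (M : Set (Amb D)) (ε : ℝ) :
    Set (Fin n → Amb D) :=
  {X | Metric.hausdorffEDist (Mhat X) M ≤ ENNReal.ofReal ε}

end MetricLearning

end

/-!
The proof compares the intrinsic distance of `M` with other distances through the nearest-point map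
of `M`, and bounds the intrinsic diameter by a packing argument.

*Reach.* Let `M` be compact with reach at least `r`. Below distance `r` the nearest point is unique,
so the distance function to `M` grows at unit rate in the direction that points away from the
nearest point (`exists_infDist_growth`). A variational argument in the spirit of Ekeland
(`exists_infDist_eq_add`) turns this into: the nearest point of `x` stays nearest along
the whole ray issued from it through `x`, up to distance `r`. Hence `M` avoids a tangent ball of
radius `r` (`inner_le_of_dist_eq_infDist`), and the nearest-point map is `(1 - m / r)⁻¹`-Lipschitz on the
`m`-offset of `M` (`norm_nearest_sub_le`). Applied to a segment, it bounds intrinsic distances by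
Euclidean ones at small scale (`geodesicDist_le_mul_edist`). Applied to paths in the `2ε`-offset, it
gives the loss bound `2ε / r` when the estimator is `ε`-precise
(`lossInf_plugInDist_le_of_hausdorffEDist_le`). The bound `1 + Δ / ε`, valid for every estimator,
only uses that points at distance at most `ε` are joined by a segment in the offset
(`lossInf_plugInDist_le`).

*Volume.* For a `C^2` submanifold the avoided balls are those tangent to the tangent spaces
(`inner_le_of_mem_orthogonal_tangentSpace`). This controls the variation of tangent spaces at rate
`3 / r` infinitesimally (`exists_gap_tangentSpace_le`), hence, along the projection of a segment, up
to distance `r / 4`, where tangent spaces are still transverse to the normal space at the centre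
(`gap_tangentSpace_lt_one`). So the orthogonal projection to the tangent space at `p` is open on
`M ∩ B(p, r / 4)`, and since it cannot lose more than the factor `√(1 - 1 / 8²)` at the boundary, a
continuity argument shows that its image contains the ball of radius `√(1 - 1 / 8²) r / 4`
(`exists_starProjection_eq`). As projections do not increase Hausdorff measure, this bounds the
volume of `M ∩ B(p, r / 4)` from below (`le_euclideanHausdorffMeasure_inter_ball`).

*Diameter.* Since `M` is connected, the intrinsic distance to `x` takes all intermediate values on
`M`. Points at intrinsic distances `0, r, 2r, …` from `x` are pairwise at Euclidean distance
at least `r / 2`, so that the balls of radius `r / 4` around them are disjoint, and the volume bound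
limits their number (`IsModelDistribution.geodesicDist_le`).
-/

open Metric Filter Topology

namespace MetricLearning

/-! ### Intrinsic distances -/

section PathLength

variable {E : Type*} [NormedAddCommGroup E]

theorem geodesicDist_mono {K K' : Set E} (h : K ⊆ K') (x y : E) :
    geodesicDist K' x y ≤ geodesicDist K x y :=
  le_iInf₂ fun γ hγ => iInf₂_le γ fun t => h (hγ t)

theorem edist_le_geodesicDist (K : Set E) (x y : E) : edist x y ≤ geodesicDist K x y := by
  refine le_iInf₂ fun γ _ => ?_
  simpa using eVariationOn.edist_le (f := γ) (s := univ) (mem_univ 0) (mem_univ 1)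

/-- The length of a concatenation of paths is at most the sum of the lengths. -/
theorem eVariationOn_trans_le {x y z : E} (γ : Path x y) (γ' : Path y z) :
    eVariationOn (γ.trans γ') univ ≤ eVariationOn γ univ + eVariationOn γ' univ := by
  let h : unitInterval := ⟨1 / 2, by norm_num, by norm_num⟩
  have hu : (univ : Set unitInterval) = Iic h ∪ Ici h := by
    ext t; simp
  rw [hu, eVariationOn.union _ (isGreatest_Iic) (isLeast_Ici)]
  refine add_le_add ?_ ?_
  · have : EqOn (γ.trans γ')
        (γ ∘ fun t : unitInterval => Set.projIcc (0 : ℝ) 1 zero_le_one (2 * (t : ℝ))) (Iic h) := by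
      intro t ht
      have ht' : (t : ℝ) ≤ 1 / 2 := ht
      simp only [Path.trans_apply, ht', dif_pos, Function.comp]
      congr 1
      exact (projIcc_of_mem _ _).symm
    rw [eVariationOn.congr this]
    refine (eVariationOn.comp_le_of_monotoneOn γ _ (t := Iic h) (s := univ) ?_
      (fun _ _ => mem_univ _)).trans (by rw [← hu])
    intro a _ b _ hab
    exact monotone_projIcc _ (by gcongr)
  · have : EqOn (γ.trans γ')
        (γ' ∘ fun t : unitInterval => Set.projIcc (0 : ℝ) 1 zero_le_one (2 * (t : ℝ) - 1))
        (Ici h) := by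
      intro t ht
      have ht' : 1 / 2 ≤ (t : ℝ) := ht
      rcases ht'.eq_or_lt with h1 | h1
      · have : t = h := Subtype.ext h1.symm
        subst this
        simp [Path.trans_apply, h]
      · simp only [Path.trans_apply, not_le.2 h1, dif_neg, not_false_iff, Function.comp]
        congr 1
        exact (projIcc_of_mem _ _).symm
    rw [eVariationOn.congr this]
    refine (eVariationOn.comp_le_of_monotoneOn γ' _ (t := Ici h) (s := univ) ?_
      (fun _ _ => mem_univ _)).trans (by rw [← hu])
    intro a _ b _ hab
    exact monotone_projIcc _ (by gcongr)

theorem geodesicDist_triangle (K : Set E) (x y z : E) :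
    geodesicDist K x z ≤ geodesicDist K x y + geodesicDist K y z := by
  simp only [geodesicDist, ENNReal.iInf_add, ENNReal.add_iInf]
  refine le_iInf₂ fun γ' hγ' => le_iInf₂ fun γ hγ => ?_
  refine (iInf₂_le (γ.trans γ') ?_).trans (eVariationOn_trans_le γ γ')
  intro t
  rw [Path.trans_apply]
  split_ifs
  exacts [hγ _, hγ' _]

/-- A map that is Lipschitz on `K` and sends `K` into `M` multiplies intrinsic distances by at most
its Lipschitz constant. -/
theorem geodesicDist_le_of_lipschitzOnWith {K M : Set E} {f : E → E} {C : NNReal} (hC : C ≠ 0)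
    (hf : LipschitzOnWith C f K) (hKM : MapsTo f K M) (x y : E) :
    geodesicDist M (f x) (f y) ≤ C * geodesicDist K x y := by
  have hC' : (C : ℝ≥0∞) ≠ 0 := by simpa using hC
  simp only [geodesicDist, ENNReal.mul_iInf_of_ne hC' ENNReal.coe_ne_top]
  refine le_iInf₂ fun γ hγ => ?_
  let γ' : Path (f x) (f y) :=
    ⟨⟨fun t => f (γ t), hf.continuousOn.comp_continuous γ.continuous hγ⟩, by simp, by simp⟩
  exact (iInf₂_le γ' fun t => hKM (hγ t)).trans
    (hf.comp_eVariationOn_le (g := γ) (s := univ) fun t _ => hγ t)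

/-- Two points joined by a segment inside `K` have the same intrinsic and Euclidean distance. -/
theorem geodesicDist_le_of_segment_subset [NormedSpace ℝ E] {K : Set E} {x y : E}
    (h : segment ℝ x y ⊆ K) : geodesicDist K x y ≤ edist x y := by
  have hl := (lipschitzWith_lineMap (𝕜 := ℝ) x y).lipschitzOnWith (s := Icc (0 : ℝ) 1)
  let γ : Path x y := ⟨⟨fun t : unitInterval => AffineMap.lineMap x y (t : ℝ), by fun_prop⟩,
    by simp, by simp⟩
  refine (iInf₂_le γ fun t => h ?_).trans ?_
  · rw [segment_eq_image_lineMap]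
    exact ⟨t, t.2, rfl⟩
  · refine (hl.comp_eVariationOn_le (g := fun t : unitInterval => (t : ℝ)) (s := univ)
      fun t _ => t.2).trans ?_
    have h1 : eVariationOn (fun t : unitInterval => (t : ℝ)) univ ≤ 1 := by
      have hm : MonotoneOn (fun t : unitInterval => (t : ℝ)) univ := fun a _ b _ hab => hab
      have := hm.eVariationOn_eq (mem_univ 0) (mem_univ 1)
      have hu : (univ ∩ Icc 0 1 : Set unitInterval) = univ := by
        ext t; simpa using unitInterval.le_one'
      rw [hu] at this
      simp [this]
    calc (nndist x y : ℝ≥0∞) * _ ≤ nndist x y * 1 := by gcongr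
      _ = edist x y := by rw [mul_one, edist_nndist]

end PathLength

end MetricLearning

namespace MetricLearning

/-! ### Sets of positive reach -/

section Reach

/-- Below the reach the nearest point is unique, since the medial axis is avoided. -/
theorem eq_of_dist_eq_infDist {E : Type*} [NormedAddCommGroup E] {M : Set E} {r : ℝ}
    (hreach : ENNReal.ofReal r ≤ reach M) {z p q : E}
    (hz : infDist z M < r) (hp : p ∈ M) (hq : q ∈ M)
    (hzp : dist z p = infDist z M) (hzq : dist z q = infDist z M) : p = q := by
  by_contra hne
  have hE : ENNReal.ofReal (infDist z M) = infEDist z M :=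
    ENNReal.ofReal_toReal (infEDist_ne_top ⟨p, hp⟩)
  have hm : z ∈ medialAxis M := ⟨p, hp, q, hq, hne, by rw [edist_dist, hzp, hE],
    by rw [edist_dist, hzq, hE]⟩
  have h1 : ENNReal.ofReal r ≤ infEDist z M := hreach.trans (iInf₂_le z hm)
  rw [← hE, ENNReal.ofReal_le_ofReal_iff infDist_nonneg] at h1
  exact absurd hz (not_lt.2 h1)

variable {E : Type*} [NormedAddCommGroup E] [InnerProductSpace ℝ E] {M : Set E} {r : ℝ}

/-- Below the reach, the distance function to `M` increases at unit rate in the direction pointing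
away from the nearest point. -/
theorem exists_infDist_growth (hM : IsCompact M) (hne : M.Nonempty)
    (hreach : ENNReal.ofReal r ≤ reach M) {z : E} (hz0 : 0 < infDist z M) (hz : infDist z M < r)
    {κ t : ℝ} (hκ : 0 < κ) (hκ1 : κ ≤ 1) (ht : 0 < t) :
    ∃ z', dist z' z ≤ t ∧ infDist z M + (1 - κ) * dist z' z < infDist z' M := by
  obtain ⟨q, hq, hzq⟩ := hM.exists_infDist_eq_dist hne z
  set δ := infDist z M with hδ
  have hnq : ‖z - q‖ = δ := by rw [hzq, dist_eq_norm]
  set u : E := δ⁻¹ • (z - q) with hu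
  have hu1 : ‖u‖ = 1 := by
    rw [hu, norm_smul, hnq, norm_inv, Real.norm_of_nonneg hz0.le, inv_mul_cancel₀ hz0.ne']
  by_contra! H
  -- failing along `z + e n • u` with `e n → 0` contradicts `⟪z - q, u⟫ = δ` in the limit
  let e : ℕ → ℝ := fun n => t / (n + 1)
  have he0 : ∀ n, 0 < e n := fun n => by positivity
  have het : ∀ n, e n ≤ t := fun n => div_le_self ht.le (by linarith [n.cast_nonneg (α := ℝ)])
  have he : Tendsto e atTop (𝓝 0) := tendsto_const_div_atTop_nhds_zero_nat t |>.comp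
    (tendsto_add_atTop_nat 1) |>.congr fun n => by simp [e]
  have hdist : ∀ n, dist (z + e n • u) z = e n := fun n => by
    rw [dist_eq_norm, add_sub_cancel_left, norm_smul, hu1, mul_one, Real.norm_of_nonneg (he0 n).le]
  have hz' : ∀ n, infDist (z + e n • u) M ≤ δ + (1 - κ) * e n := fun n => by
    have := H (z + e n • u) (by rw [hdist]; exact het n)
    rwa [hdist] at this
  choose y hyM hy using fun n => hM.exists_infDist_eq_dist hne (z + e n • u)
  obtain ⟨q', hq', φ, hφ, hlim⟩ := hM.tendsto_subseq hyM
  have heφ := he.comp hφ.tendsto_atTop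
  -- the nearest points of the perturbed points accumulate at the nearest point of `z`
  have hq'q : q = q' := by
    refine eq_of_dist_eq_infDist hreach hz hq hq' hzq.symm ?_
    have h1 : Tendsto (fun n => z + e (φ n) • u) atTop (𝓝 (z + (0 : ℝ) • u)) :=
      tendsto_const_nhds.add (heφ.smul_const u)
    rw [zero_smul, add_zero] at h1
    have h2 := h1.dist hlim
    have h3 := ((continuous_infDist_pt M).tendsto z).comp h1
    refine tendsto_nhds_unique h2 (h3.congr fun n => ?_)
    exact hy (φ n)
  subst hq'q
  have hkey : ∀ n, 2 * inner ℝ (z - y (φ n)) u ≤ 2 * δ * (1 - κ) + e (φ n) := by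
    intro n
    set ε := e (φ n)
    have hε : 0 < ε := he0 _
    have h1 := hz' (φ n)
    rw [hy, dist_eq_norm] at h1
    have h2 : ‖z + ε • u - y (φ n)‖ ^ 2 =
        ‖z - y (φ n)‖ ^ 2 + 2 * ε * inner ℝ (z - y (φ n)) u + ε ^ 2 := by
      rw [show z + ε • u - y (φ n) = (z - y (φ n)) + ε • u by abel, norm_add_sq_real,
        inner_smul_right, norm_smul, hu1, Real.norm_of_nonneg hε.le]
      ring
    have h3 : δ ≤ ‖z - y (φ n)‖ := by
      rw [← dist_eq_norm]; exact infDist_le_dist_of_mem (hyM _)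
    have h4 : ‖z + ε • u - y (φ n)‖ ^ 2 ≤ (δ + (1 - κ) * ε) ^ 2 := by gcongr
    have h5 : δ ^ 2 ≤ ‖z - y (φ n)‖ ^ 2 := by gcongr
    have h6 : (1 - κ) ^ 2 ≤ 1 := by nlinarith
    refine le_of_mul_le_mul_left ?_ hε
    nlinarith [mul_le_mul_of_nonneg_right h6 (sq_nonneg ε)]
  have hL : Tendsto (fun n => 2 * inner ℝ (z - y (φ n)) u) atTop (𝓝 (2 * inner ℝ (z - q) u)) :=
    (((tendsto_const_nhds.sub hlim).inner tendsto_const_nhds).const_mul 2)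
  have hR : Tendsto (fun n => 2 * δ * (1 - κ) + e (φ n)) atTop (𝓝 (2 * δ * (1 - κ) + 0)) :=
    tendsto_const_nhds.add heφ
  have := le_of_tendsto_of_tendsto' hL hR hkey
  have h7 : inner ℝ (z - q) u = δ := by
    rw [hu, inner_smul_right, real_inner_self_eq_norm_sq, hnq]
    field_simp
  rw [h7] at this
  nlinarith [mul_pos hz0 hκ]

/-- Maximizing `infDist · M - (1 - κ) dist · x` over a ball forces the maximizer to the boundary
(as in Ekeland's variational principle), so that the distance to `M` gains the full radius. -/
theorem exists_infDist_eq_add [ProperSpace E] (hM : IsCompact M) (hne : M.Nonempty)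
    (hreach : ENNReal.ofReal r ≤ reach M) {x : E} (hx : 0 < infDist x M) {s : ℝ} (hs : 0 ≤ s)
    (hxs : infDist x M + s < r) :
    ∃ z, dist z x ≤ s ∧ infDist x M + s ≤ infDist z M := by
  have hc : IsCompact (closedBall x s) := isCompact_closedBall x s
  have hn : (closedBall x s).Nonempty := ⟨x, mem_closedBall_self hs⟩
  have hlow : ∀ κ : ℝ, 0 < κ → κ ≤ 1 →
      ∃ z ∈ closedBall x s, infDist x M + (1 - κ) * s ≤ infDist z M := by
    intro κ hκ hκ1
    obtain ⟨z, hz, hmax⟩ := hc.exists_isMaxOn hn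
      (f := fun z => infDist z M - (1 - κ) * dist z x) (by fun_prop)
    have h0 : infDist x M ≤ infDist z M - (1 - κ) * dist z x := by
      simpa using hmax (mem_closedBall_self hs)
    have hk : 0 ≤ (1 - κ) * dist z x := mul_nonneg (by linarith) dist_nonneg
    rw [mem_closedBall] at hz
    refine ⟨z, hz, ?_⟩
    rcases hz.eq_or_lt with h | h
    · rw [h] at h0; linarith
    · exfalso
      have hzr : infDist z M < r := by
        have := infDist_le_infDist_add_dist (s := M) (x := z) (y := x)
        linarith
      obtain ⟨z', hz't, hz'⟩ := exists_infDist_growth hM hne hreach (by linarith) hzr hκ hκ1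
        (sub_pos.2 h)
      have ht := dist_triangle z' z x
      have hm : infDist z' M - (1 - κ) * dist z' x ≤ infDist z M - (1 - κ) * dist z x :=
        hmax (mem_closedBall.2 (by linarith))
      nlinarith [mul_le_mul_of_nonneg_left ht (sub_nonneg.2 hκ1)]
  obtain ⟨z, hz, hmax⟩ := hc.exists_isMaxOn hn (continuous_infDist_pt M).continuousOn
  refine ⟨z, hz, ?_⟩
  refine le_of_forall_pos_lt_add fun η hη => ?_
  obtain ⟨κ, hκ, hκ1, hκs⟩ : ∃ κ : ℝ, 0 < κ ∧ κ ≤ 1 ∧ κ * s < η := by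
    refine ⟨min 1 (η / (s + 1)), by positivity, min_le_left _ _, ?_⟩
    have : min 1 (η / (s + 1)) ≤ η / (s + 1) := min_le_right _ _
    calc min 1 (η / (s + 1)) * s ≤ η / (s + 1) * s := by gcongr
      _ < η := by rw [div_mul_eq_mul_div, div_lt_iff₀ (by positivity)]; nlinarith
  obtain ⟨w, hw, hw'⟩ := hlow κ hκ hκ1
  have : infDist w M ≤ infDist z M := hmax hw
  nlinarith

/-- If `p` is a nearest point of `x` on `M`, then `M` does not meet the open ball of radius `r`
tangent at `p` in the direction `x - p`. -/
theorem inner_le_of_dist_eq_infDist [ProperSpace E] (hM : IsCompact M)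
    (hr : 0 < r) (hreach : ENNReal.ofReal r ≤ reach M) {x p y : E} (hp : p ∈ M)
    (hxp : dist x p = infDist x M) (hx : infDist x M < r) (hy : y ∈ M) :
    inner ℝ (y - p) (x - p) ≤ ‖x - p‖ * ‖y - p‖ ^ 2 / (2 * r) := by
  rcases (infDist_nonneg (x := x) (s := M)).eq_or_lt with h0 | h0
  · have : x = p := by rw [← dist_eq_zero, hxp, h0]
    simp [this]
  set δ := infDist x M with hδ
  have hnx : ‖x - p‖ = δ := by rw [← dist_eq_norm, hxp]
  have key : ∀ T, δ ≤ T → T < r → 2 * T * inner ℝ (y - p) (x - p) ≤ δ * ‖y - p‖ ^ 2 := by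
    intro T hT hTr
    obtain ⟨z, hz, hz'⟩ := exists_infDist_eq_add hM ⟨p, hp⟩ hreach h0 (sub_nonneg.2 hT)
      (by linarith : infDist x M + (T - δ) < r)
    have hzT : T ≤ infDist z M := by linarith
    rw [dist_eq_norm] at hz
    have h1 : T ≤ ‖z - p‖ := by
      rw [← dist_eq_norm]; exact hzT.trans (infDist_le_dist_of_mem hp)
    have h2 : T ≤ ‖z - y‖ := by
      rw [← dist_eq_norm]; exact hzT.trans (infDist_le_dist_of_mem hy)
    -- equality in the triangle inequality puts `z` on the ray from `p` through `x`
    have h3 : z - x = ((T - δ) / δ) • (x - p) := by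
      rw [← sub_eq_zero, ← norm_eq_zero, ← sq_eq_zero_iff]
      refine le_antisymm ?_ (sq_nonneg _)
      have h4 : ‖z - p‖ ^ 2 = ‖z - x‖ ^ 2 + 2 * inner ℝ (z - x) (x - p) + δ ^ 2 := by
        rw [← hnx, ← norm_add_sq_real]; congr 2; abel
      have hT0 : 0 ≤ T := h0.le.trans hT
      have h5 : T ^ 2 ≤ ‖z - p‖ ^ 2 := by gcongr
      have h6 : ‖z - x‖ ^ 2 ≤ (T - δ) ^ 2 := by gcongr
      rw [norm_sub_sq_real, inner_smul_right, norm_smul, hnx, Real.norm_of_nonneg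
        (div_nonneg (sub_nonneg.2 hT) h0.le), div_mul_cancel₀ _ h0.ne']
      have h7 : 0 ≤ (T - δ) / δ := div_nonneg (sub_nonneg.2 hT) h0.le
      have h8 : (T - δ) / δ * δ = T - δ := div_mul_cancel₀ _ h0.ne'
      nlinarith [mul_le_mul_of_nonneg_left h6 h7, mul_le_mul_of_nonneg_left h5 h7]
    have h9 : z - p = (T / δ) • (x - p) := by
      have : z - p = (z - x) + (x - p) := by abel
      rw [this, h3]
      nth_rewrite 2 [← one_smul ℝ (x - p)]
      rw [← add_smul]; congr 1; field_simp; ring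
    have h10 : ‖z - p‖ = T := by
      rw [h9, norm_smul, hnx, Real.norm_of_nonneg (div_nonneg (h0.le.trans hT) h0.le),
        div_mul_cancel₀ _ h0.ne']
    have h11 : ‖z - y‖ ^ 2 = ‖z - p‖ ^ 2 - 2 * inner ℝ (z - p) (y - p) + ‖y - p‖ ^ 2 := by
      rw [← norm_sub_sq_real]; congr 2; abel
    rw [h10, h9, inner_smul_left, real_inner_comm] at h11
    have h12 : T ^ 2 ≤ ‖z - y‖ ^ 2 := by have := h0.le.trans hT; gcongr
    have h13 : 2 * (T / δ * inner ℝ (y - p) (x - p)) ≤ ‖y - p‖ ^ 2 := by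
      simp only [conj_trivial] at h11
      linarith
    calc 2 * T * inner ℝ (y - p) (x - p) = δ * (2 * (T / δ * inner ℝ (y - p) (x - p))) := by
          field_simp
      _ ≤ _ := by gcongr
  rw [hnx, le_div_iff₀ (by positivity)]
  have hlim : Tendsto (fun T : ℝ => 2 * T * inner ℝ (y - p) (x - p)) (𝓝[<] r)
      (𝓝 (2 * r * inner ℝ (y - p) (x - p))) :=
    ((continuous_const.mul continuous_id).mul continuous_const).continuousAt.mono_left
      nhdsWithin_le_nhds
  have := le_of_tendsto hlim (by
    filter_upwards [Ioo_mem_nhdsLT hx] with T hT using key T hT.1.le hT.2)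
  linarith

/-- The nearest-point map is `(1 - m / r)⁻¹`-Lipschitz on the `m`-offset of a set of reach at
least `r`. -/
theorem norm_nearest_sub_le [ProperSpace E] (hM : IsCompact M)
    (hr : 0 < r) (hreach : ENNReal.ofReal r ≤ reach M) {m : ℝ} (hm : m < r) {z₁ z₂ q₁ q₂ : E}
    (hq₁ : q₁ ∈ M) (hq₂ : q₂ ∈ M) (h₁ : dist z₁ q₁ = infDist z₁ M) (h₂ : dist z₂ q₂ = infDist z₂ M)
    (hm₁ : infDist z₁ M ≤ m) (hm₂ : infDist z₂ M ≤ m) :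
    (1 - m / r) * ‖q₁ - q₂‖ ≤ ‖z₁ - z₂‖ := by
  have a₁ := inner_le_of_dist_eq_infDist hM hr hreach hq₁ h₁ (hm₁.trans_lt hm) hq₂
  have a₂ := inner_le_of_dist_eq_infDist hM hr hreach hq₂ h₂ (hm₂.trans_lt hm) hq₁
  rw [← dist_eq_norm z₁, h₁, norm_sub_rev] at a₁
  rw [← dist_eq_norm z₂, h₂] at a₂
  have b : inner ℝ (q₁ - q₂) (z₁ - z₂) = ‖q₁ - q₂‖ ^ 2 - inner ℝ (q₂ - q₁) (z₁ - q₁)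
      - inner ℝ (q₁ - q₂) (z₂ - q₂) := by
    rw [← real_inner_self_eq_norm_sq, ← neg_sub q₁ q₂, inner_neg_left, sub_neg_eq_add,
      ← inner_add_right, ← inner_sub_right]
    congr 1; abel
  have c := real_inner_le_norm (q₁ - q₂) (z₁ - z₂)
  rcases (norm_nonneg (q₁ - q₂)).eq_or_lt with h0 | h0
  · rw [← h0, mul_zero]; positivity
  refine le_of_mul_le_mul_left ?_ h0
  have d : ∀ a, a ≤ m → a * ‖q₁ - q₂‖ ^ 2 / (2 * r) ≤ m * ‖q₁ - q₂‖ ^ 2 / (2 * r) := by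
    intro a ha; gcongr
  have e : ‖q₁ - q₂‖ * ((1 - m / r) * ‖q₁ - q₂‖) =
      ‖q₁ - q₂‖ ^ 2 - 2 * (m * ‖q₁ - q₂‖ ^ 2 / (2 * r)) := by
    field_simp
  rw [e]
  linarith [d _ hm₁, d _ hm₂]

/-- A nearest-point retraction onto `M`, with its Lipschitz constants on the offsets of `M`. -/
theorem exists_nearestPoint_map [ProperSpace E] (hM : IsCompact M) (hne : M.Nonempty)
    (hr : 0 < r) (hreach : ENNReal.ofReal r ≤ reach M) :
    ∃ f : E → E, (∀ z, f z ∈ M) ∧ (∀ z ∈ M, f z = z) ∧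
      ∀ m < r, LipschitzOnWith (Real.toNNReal (1 - m / r)⁻¹) f {z | infDist z M ≤ m} := by
  choose f hf hfd using fun z => hM.exists_infDist_eq_dist hne z
  refine ⟨f, hf, fun z hz => ?_, fun m hm => ?_⟩
  · have := hfd z
    rw [infDist_zero_of_mem hz] at this
    exact (dist_eq_zero.1 this.symm).symm
  · have hpos : 0 < 1 - m / r := by rw [sub_pos, div_lt_one hr]; exact hm
    refine LipschitzOnWith.of_dist_le_mul fun z₁ h₁ z₂ h₂ => ?_
    rw [Real.coe_toNNReal _ (inv_pos.2 hpos).le, dist_eq_norm, dist_eq_norm, inv_mul_eq_div,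
      le_div_iff₀' hpos]
    exact norm_nearest_sub_le hM hr hreach hm (hf _) (hf _) (hfd _).symm (hfd _).symm h₁ h₂

/-- Comparison of the intrinsic distances of `M` and of a subset of its `m`-offset. -/
theorem geodesicDist_le_of_infDist_le [ProperSpace E] (hM : IsCompact M)
    (hr : 0 < r) (hreach : ENNReal.ofReal r ≤ reach M) {m : ℝ} (hm : m < r) {K : Set E}
    (hK : ∀ z ∈ K, infDist z M ≤ m) {x y : E} (hx : x ∈ M) (hy : y ∈ M) :
    geodesicDist M x y ≤ ENNReal.ofReal (1 - m / r)⁻¹ * geodesicDist K x y := by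
  obtain ⟨f, hf, hfix, hlip⟩ := exists_nearestPoint_map hM ⟨x, hx⟩ hr hreach
  have hpos : 0 < 1 - m / r := by rw [sub_pos, div_lt_one hr]; exact hm
  have h := geodesicDist_le_of_lipschitzOnWith (M := M) (f := f) (C := Real.toNNReal (1 - m / r)⁻¹)
    (by simpa using hpos) ((hlip m hm).mono hK) (fun z _ => hf z) x y
  rwa [hfix x hx, hfix y hy] at h

theorem infDist_le_of_mem_segment {x y z : E} (hx : x ∈ M) (hy : y ∈ M) (hz : z ∈ segment ℝ x y) :
    infDist z M ≤ dist x y / 2 := by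
  have h : dist x z + dist z y = dist x y := dist_add_dist_of_mem_segment hz
  rcases le_total (dist x z) (dist z y) with h' | h'
  · refine (infDist_le_dist_of_mem hx).trans ?_
    rw [dist_comm]; linarith
  · exact (infDist_le_dist_of_mem hy).trans (by linarith)

/-- Small-scale comparison of intrinsic and Euclidean distances, by projecting a segment. -/
theorem geodesicDist_le_mul_edist [ProperSpace E] (hM : IsCompact M)
    (hr : 0 < r) (hreach : ENNReal.ofReal r ≤ reach M) {m : ℝ} (hm : m < r)
    {x y : E} (hx : x ∈ M) (hy : y ∈ M) (hxy : dist x y ≤ 2 * m) :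
    geodesicDist M x y ≤ ENNReal.ofReal ((1 - m / r)⁻¹ * dist x y) := by
  refine (geodesicDist_le_of_infDist_le hM hr hreach hm (K := segment ℝ x y) (fun z hz =>
    (infDist_le_of_mem_segment hx hy hz).trans (by linarith)) hx hy).trans ?_
  have hpos : 0 < 1 - m / r := by rw [sub_pos, div_lt_one hr]; exact hm
  rw [ENNReal.ofReal_mul (inv_pos.2 hpos).le, ← edist_dist]
  gcongr
  exact geodesicDist_le_of_segment_subset subset_rfl

end Reach

end MetricLearning

namespace MetricLearning

/-! ### Tangent spaces of submanifolds -/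

section Local

/-- Second-order Taylor bound: the derivative of a `C^2` map is locally Lipschitz. -/
theorem exists_norm_sub_fderiv_le {E F : Type*} [NormedAddCommGroup E] [NormedSpace ℝ E]
    [NormedAddCommGroup F] [NormedSpace ℝ F] {f : E → F} {a : E} (hf : ContDiffAt ℝ 2 f a) :
    ∃ C η : ℝ, 0 ≤ C ∧ 0 < η ∧
      ∀ b, ‖b - a‖ < η → ‖f b - f a - fderiv ℝ f a (b - a)‖ ≤ C * ‖b - a‖ ^ 2 := by
  have h1 : ContDiffAt ℝ 1 (fderiv ℝ f) a := hf.fderiv_right (by norm_num)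
  obtain ⟨K, t, ht, hK⟩ := h1.exists_lipschitzOnWith
  have hd : ∀ᶠ b in 𝓝 a, DifferentiableAt ℝ f b :=
    (hf.eventually (by simp)).mono fun b hb => hb.differentiableAt (by simp)
  obtain ⟨η, hη, hball⟩ := Metric.mem_nhds_iff.1 (inter_mem ht hd)
  refine ⟨K, η, K.2, hη, fun b hb => ?_⟩
  have hsub : closedBall a ‖b - a‖ ⊆ ball a η := closedBall_subset_ball hb
  have := (convex_closedBall a ‖b - a‖).norm_image_sub_le_of_norm_hasFDerivWithin_le'
    (f := f) (f' := fderiv ℝ f) (φ := fderiv ℝ f a) (C := K * ‖b - a‖) (x := a) (y := b)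
    (fun x hx => (hball (hsub hx)).2.hasFDerivAt.hasFDerivWithinAt) (fun x hx => ?_)
    (mem_closedBall_self (norm_nonneg _)) (by simp [dist_eq_norm])
  · refine this.trans (le_of_eq (by ring))
  · refine (hK.norm_sub_le (hball (hsub hx)).1 (hball (mem_ball_self hη)).1).trans ?_
    gcongr
    simpa [dist_eq_norm] using hx

variable {E : Type*} [NormedAddCommGroup E] [InnerProductSpace ℝ E] [FiniteDimensional ℝ E]
  {M : Set E} {d k : ℕ}

/-- A submanifold of class `C^2` is, to second order, a graph over its tangent space. -/
theorem IsSubmanifoldOfClass.exists_local (hM : IsSubmanifoldOfClass d k M) (hk : 2 ≤ k) {p : E}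
    (hp : p ∈ M) : Module.finrank ℝ (tangentSpace M p) = d ∧
      ∃ C η : ℝ, 0 < C ∧ 0 < η ∧
        (∀ e ∈ tangentSpace M p, ‖e‖ < η → ∃ y ∈ M, ‖y - (p + e)‖ ≤ C * ‖e‖ ^ 2) ∧
        (∀ y ∈ M, ‖y - p‖ < η → ∃ e ∈ tangentSpace M p, ‖y - p - e‖ ≤ C * ‖y - p‖ ^ 2) := by
  obtain ⟨φ, F, hps, hF, hφ, hψ, hI⟩ := hM p hp
  set a := φ p with ha
  have hat : a ∈ φ.target := φ.map_source hps
  have haF : a ∈ (F : Set E) := (hI hps).2 hp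
  have hk' : (2 : WithTop ℕ∞) ≤ (k : WithTop ℕ∞) := by exact_mod_cast hk
  have hφ2 : ContDiffAt ℝ 2 φ p := (hφ.contDiffAt (φ.open_source.mem_nhds hps)).of_le hk'
  have hψ2 : ContDiffAt ℝ 2 φ.symm a := (hψ.contDiffAt (φ.open_target.mem_nhds hat)).of_le hk'
  have hψa : φ.symm a = p := φ.left_inv hps
  set A := fderiv ℝ φ.symm a with hA
  set B := fderiv ℝ φ p with hB
  have hdφ : HasFDerivAt φ B p := (hφ2.differentiableAt (by simp)).hasFDerivAt
  have hdψ : HasFDerivAt φ.symm A a := (hψ2.differentiableAt (by simp)).hasFDerivAt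
  have hBA : ∀ v, B (A v) = v := by
    have h1 : HasFDerivAt (φ ∘ φ.symm) (B.comp A) a :=
      HasFDerivAt.comp a (by rw [hψa]; exact hdφ) hdψ
    have h2 : HasFDerivAt (φ ∘ φ.symm) (ContinuousLinearMap.id ℝ E) a := by
      refine (hasFDerivAt_id a).congr_of_eventuallyEq ?_
      filter_upwards [φ.open_target.mem_nhds hat] with b hb using φ.right_inv hb
    intro v
    simpa using DFunLike.congr_fun (h1.unique h2) v
  have hAinj : Function.Injective A := Function.LeftInverse.injective hBA
  -- `W` satisfies the two local estimates, which then identify it with the tangent space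
  set W : Submodule ℝ E := F.map (A : E →ₗ[ℝ] E) with hW
  have hWd : Module.finrank ℝ W = d := by
    rw [← hF]
    exact (Submodule.equivMapOfInjective (A : E →ₗ[ℝ] E) hAinj F).finrank_eq.symm
  obtain ⟨C₁, η₁, hC₁, hη₁, hT⟩ := exists_norm_sub_fderiv_le hψ2
  rw [hψa, ← hA] at hT
  have two : ∃ C η : ℝ, 0 < C ∧ 0 < η ∧
      (∀ e ∈ W, ‖e‖ < η → ∃ y ∈ M, ‖y - (p + e)‖ ≤ C * ‖e‖ ^ 2) ∧
      (∀ y ∈ M, ‖y - p‖ < η → ∃ e ∈ W, ‖y - p - e‖ ≤ C * ‖y - p‖ ^ 2) := by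
    obtain ⟨K, t, ht, hK⟩ := (hφ2.of_le one_le_two).exists_lipschitzOnWith
    obtain ⟨η₂, hη₂, hball₂⟩ := Metric.mem_nhds_iff.1 (inter_mem ht (φ.open_source.mem_nhds hps))
    obtain ⟨η₃, hη₃, hball₃⟩ := Metric.mem_nhds_iff.1 (φ.open_target.mem_nhds hat)
    have hL : ∀ L : ℝ, 0 ≤ L → L * (min η₁ η₃ / (L + 1)) < min η₁ η₃ := fun L hL => by
      rw [← mul_div_assoc, div_lt_iff₀ (by positivity)]
      nlinarith [lt_min hη₁ hη₃]
    refine ⟨C₁ * ‖B‖ ^ 2 + C₁ * K ^ 2 + 1,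
      min (min η₁ η₃ / (‖B‖ + 1)) (min η₂ (min η₁ η₃ / (K + 1))), by positivity, by positivity,
      ?_, ?_⟩
    · rintro e ⟨f, hf, rfl⟩ he
      have hfB : ‖f‖ ≤ ‖B‖ * ‖A f‖ := by
        conv_lhs => rw [← hBA f]
        exact B.le_opNorm _
      have hf3 : ‖f‖ < min η₁ η₃ := by
        refine (hfB.trans ?_).trans_lt (hL _ (norm_nonneg B))
        gcongr
        exact (he.trans_le (min_le_left _ _)).le
      have hmem : a + f ∈ φ.target := hball₃ (by
        simpa [dist_eq_norm] using hf3.trans_le (min_le_right _ _))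
      refine ⟨φ.symm (a + f), ?_, ?_⟩
      · rw [← hI (φ.map_target hmem), φ.right_inv hmem]
        exact F.add_mem haF hf
      · have := hT (a + f) (by simpa using hf3.trans_le (min_le_left _ _))
        rw [add_sub_cancel_left] at this
        rw [← sub_sub]
        refine this.trans ?_
        calc C₁ * ‖f‖ ^ 2 ≤ C₁ * (‖B‖ * ‖A f‖) ^ 2 := by gcongr
          _ = C₁ * ‖B‖ ^ 2 * ‖A f‖ ^ 2 := by ring
          _ ≤ _ := by
            gcongr
            · nlinarith [mul_nonneg hC₁ (sq_nonneg (K : ℝ))]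
            · exact le_rfl
    · intro y hy hyp
      have hy2 : y ∈ ball p η₂ := by
        simpa [dist_eq_norm] using hyp.trans_le ((min_le_right _ _).trans (min_le_left _ _))
      have hys := (hball₂ hy2).2
      have hlip : ‖φ y - a‖ ≤ K * ‖y - p‖ :=
        hK.norm_sub_le (hball₂ hy2).1 (hball₂ (mem_ball_self hη₂)).1
      have hφy : ‖φ y - a‖ < min η₁ η₃ := by
        refine (hlip.trans ?_).trans_lt (hL K K.2)
        gcongr
        exact (hyp.trans_le ((min_le_right _ _).trans (min_le_right _ _))).le
      refine ⟨A (φ y - a), ⟨φ y - a, F.sub_mem ((hI hys).2 hy) haF, rfl⟩, ?_⟩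
      have := hT (φ y) (hφy.trans_le (min_le_left _ _))
      rw [φ.left_inv hys] at this
      refine this.trans ?_
      calc C₁ * ‖φ y - a‖ ^ 2 ≤ C₁ * (K * ‖y - p‖) ^ 2 := by gcongr
        _ = C₁ * K ^ 2 * ‖y - p‖ ^ 2 := by ring
        _ ≤ _ := by
          gcongr
          nlinarith [mul_nonneg hC₁ (sq_nonneg ‖B‖)]
  obtain ⟨C, η, hC, hη, h1, h2⟩ := two
  have hWT : W = tangentSpace M p := by
    apply le_antisymm
    · intro e he
      refine Submodule.subset_span ?_
      have hy : ∀ n : ℕ, ∃ d : E, (‖((n : ℝ) + 1)⁻¹ • e‖ < η → p + d ∈ M) ∧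
          ‖d - ((n : ℝ) + 1)⁻¹ • e‖ ≤ C * ‖((n : ℝ) + 1)⁻¹ • e‖ ^ 2 := by
        intro n
        by_cases hn : ‖((n : ℝ) + 1)⁻¹ • e‖ < η
        · obtain ⟨y, hy, hy'⟩ := h1 _ (W.smul_mem _ he) hn
          exact ⟨y - p, fun _ => by simpa using hy, by rwa [sub_sub]⟩
        · exact ⟨((n : ℝ) + 1)⁻¹ • e, fun h => absurd h hn, by simp; positivity⟩
      choose dd hd1 hd2 using hy
      have hinv : Tendsto (fun n : ℕ => ((n : ℝ) + 1)⁻¹) atTop (𝓝 0) := by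
        simpa using tendsto_one_div_add_atTop_nhds_zero_nat (𝕜 := ℝ)
      have hs : Tendsto (fun n : ℕ => ((n : ℝ) + 1)⁻¹ • e) atTop (𝓝 0) := by
        simpa using hinv.smul_const e
      have hc : Tendsto (fun n : ℕ => ((n : ℝ) + 1) • dd n) atTop (𝓝 e) := by
        rw [tendsto_iff_norm_sub_tendsto_zero]
        have hb : Tendsto (fun n : ℕ => C * ‖e‖ ^ 2 * ((n : ℝ) + 1)⁻¹) atTop (𝓝 0) := by
          simpa using hinv.const_mul (C * ‖e‖ ^ 2)
        refine squeeze_zero (fun _ => norm_nonneg _) (fun n => ?_) hb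
        have hn : (0 : ℝ) < (n : ℝ) + 1 := by positivity
        have : ((n : ℝ) + 1) • dd n - e = ((n : ℝ) + 1) • (dd n - ((n : ℝ) + 1)⁻¹ • e) := by
          rw [smul_sub, smul_inv_smul₀ hn.ne']
        rw [this, norm_smul, Real.norm_of_nonneg hn.le]
        calc _ ≤ ((n : ℝ) + 1) * (C * ‖((n : ℝ) + 1)⁻¹ • e‖ ^ 2) := by gcongr; exact hd2 n
          _ = _ := by
            rw [norm_smul, Real.norm_of_nonneg (inv_pos.2 hn).le]
            field_simp
      refine mem_tangentConeAt_of_seq atTop (fun n : ℕ => (n : ℝ) + 1) dd ?_ ?_ hc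
      · have := hinv.smul hc
        rw [zero_smul] at this
        refine this.congr fun n => ?_
        rw [inv_smul_smul₀ (by positivity)]
      · have : ∀ᶠ n : ℕ in atTop, ‖((n : ℝ) + 1)⁻¹ • e‖ < η := by
          have := hs.norm
          rw [norm_zero] at this
          exact this.eventually_lt_const hη
        filter_upwards [this] with n hn using hd1 n hn
    · refine Submodule.span_le.2 fun v hv => ?_
      obtain ⟨α, l, hl, c, dd, hd0, hdM, hcd⟩ := exists_fun_of_mem_tangentConeAt hv
      rw [SetLike.mem_coe, ← Submodule.starProjection_eq_self_iff, eq_comm, ← sub_eq_zero,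
        ← norm_eq_zero]
      have hL : Tendsto (fun n => ‖c n • dd n - W.starProjection (c n • dd n)‖) l
          (𝓝 ‖v - W.starProjection v‖) :=
        (hcd.sub ((W.starProjection.continuous.tendsto v).comp hcd)).norm
      have hR : Tendsto (fun n => C * ‖dd n‖ * ‖c n • dd n‖) l (𝓝 (C * 0 * ‖v‖)) := by
        have := hd0.norm
        rw [norm_zero] at this
        exact (this.const_mul C).mul hcd.norm
      rw [mul_zero, zero_mul] at hR
      refine le_antisymm (le_of_tendsto_of_tendsto hL hR ?_) (norm_nonneg _)
      have hsm : ∀ᶠ n in l, ‖dd n‖ < η := by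
        have := hd0.norm
        rw [norm_zero] at this
        exact this.eventually_lt_const hη
      filter_upwards [hsm, hdM] with n hn hnM
      obtain ⟨e, he, hle⟩ := h2 _ hnM (by simpa using hn)
      rw [add_sub_cancel_left] at hle
      have hmin : ‖dd n - W.starProjection (dd n)‖ ≤ ‖dd n - e‖ := by
        rw [Submodule.starProjection_minimal]
        exact ciInf_le ⟨0, by rintro _ ⟨x, rfl⟩; positivity⟩ (⟨e, he⟩ : W)
      rw [map_smul, ← smul_sub, norm_smul, norm_smul]
      calc ‖c n‖ * ‖dd n - W.starProjection (dd n)‖ ≤ ‖c n‖ * (C * ‖dd n‖ ^ 2) := by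
            gcongr; exact hmin.trans hle
        _ = _ := by ring
  rw [hWT] at hWd h1 h2
  exact ⟨hWd, C, η, hC, hη, h1, h2⟩

end Local

end MetricLearning

namespace MetricLearning

/-! ### The gap between subspaces -/

section Gap

variable {E : Type*} [NormedAddCommGroup E] [InnerProductSpace ℝ E] [FiniteDimensional ℝ E]
  {U V W : Submodule ℝ E}

/-- The gap from `U` to `V`: the sine of the largest angle between a vector of `U` and the
subspace `V`. -/
noncomputable def gap (U V : Submodule ℝ E) : ℝ := ‖Vᗮ.starProjection ∘L U.starProjection‖

theorem gap_nonneg (U V : Submodule ℝ E) : 0 ≤ gap U V := norm_nonneg _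

theorem gap_le_one (U V : Submodule ℝ E) : gap U V ≤ 1 :=
  (ContinuousLinearMap.opNorm_comp_le _ _).trans (mul_le_one₀ (Submodule.starProjection_norm_le _)
    (norm_nonneg _) (Submodule.starProjection_norm_le _))

theorem norm_sub_starProjection_le_gap {e : E} (he : e ∈ U) :
    ‖e - V.starProjection e‖ ≤ gap U V * ‖e‖ := by
  have := (Vᗮ.starProjection ∘L U.starProjection).le_opNorm e
  rwa [ContinuousLinearMap.comp_apply, Submodule.starProjection_eq_self_iff.2 he,
    Submodule.starProjection_orthogonal_val] at this

theorem inner_le_gap {e w : E} (he : e ∈ U) (hw : w ∈ Vᗮ) :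
    inner ℝ e w ≤ gap U V * ‖e‖ * ‖w‖ := by
  have h : inner ℝ e w = inner ℝ (e - V.starProjection e) w := by
    rw [inner_sub_left, Submodule.inner_right_of_mem_orthogonal (V.starProjection_apply_mem e) hw,
      sub_zero]
  rw [h]
  exact (real_inner_le_norm _ _).trans (by gcongr; exact norm_sub_starProjection_le_gap he)

theorem gap_le_of_forall_norm_le {c : ℝ} (hc : 0 ≤ c)
    (h : ∀ e ∈ U, ‖e - V.starProjection e‖ ≤ c * ‖e‖) : gap U V ≤ c := by
  refine ContinuousLinearMap.opNorm_le_bound _ hc fun x => ?_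
  rw [ContinuousLinearMap.comp_apply, Submodule.starProjection_orthogonal_val]
  refine (h _ (U.starProjection_apply_mem x)).trans ?_
  gcongr
  exact U.norm_starProjection_apply_le x

theorem gap_le_of_forall_inner_le {c : ℝ} (hc : 0 ≤ c)
    (h : ∀ e ∈ U, ∀ w ∈ Vᗮ, ‖e‖ = 1 → ‖w‖ = 1 → inner ℝ e w ≤ c) : gap U V ≤ c := by
  refine gap_le_of_forall_norm_le hc fun e he => ?_
  set w := e - V.starProjection e with hw
  have hwV : w ∈ Vᗮ := V.sub_starProjection_mem_orthogonal e
  rcases (norm_nonneg w).eq_or_lt with h0 | h0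
  · rw [← h0]; positivity
  have he0 : 0 < ‖e‖ := by
    rcases (norm_nonneg e).eq_or_lt with h1 | h1
    · rw [eq_comm, norm_eq_zero] at h1
      simp [hw, h1] at h0
    · exact h1
  have h1 := h (‖e‖⁻¹ • e) (U.smul_mem _ he) (‖w‖⁻¹ • w) (Vᗮ.smul_mem _ hwV)
    (by rw [norm_smul, norm_inv, norm_norm, inv_mul_cancel₀ he0.ne'])
    (by rw [norm_smul, norm_inv, norm_norm, inv_mul_cancel₀ h0.ne'])
  have h2 : inner ℝ e w = ‖w‖ ^ 2 := by
    rw [← real_inner_self_eq_norm_sq]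
    nth_rewrite 2 [hw]
    rw [inner_sub_left, Submodule.inner_right_of_mem_orthogonal (V.starProjection_apply_mem e) hwV,
      sub_zero]
  rw [inner_smul_left, inner_smul_right, h2, conj_trivial] at h1
  have h3 : ‖e‖⁻¹ * (‖w‖⁻¹ * ‖w‖ ^ 2) = ‖w‖ / ‖e‖ := by field_simp
  rwa [h3, div_le_iff₀ he0] at h1

theorem gap_self (U : Submodule ℝ E) : gap U U = 0 :=
  le_antisymm (gap_le_of_forall_norm_le le_rfl fun e he => by
    rw [Submodule.starProjection_eq_self_iff.2 he]; simp) (gap_nonneg _ _)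

theorem gap_triangle (U V W : Submodule ℝ E) : gap U W ≤ gap U V + gap V W := by
  refine gap_le_of_forall_norm_le (add_nonneg (gap_nonneg _ _) (gap_nonneg _ _)) fun e he => ?_
  have h1 := norm_sub_starProjection_le_gap (V := V) he
  have h2 := norm_sub_starProjection_le_gap (V := W) (V.starProjection_apply_mem e)
  have h3 : ‖e - W.starProjection e‖ ≤ ‖e - W.starProjection (V.starProjection e)‖ := by
    rw [Submodule.starProjection_minimal]
    exact ciInf_le ⟨0, by rintro _ ⟨x, rfl⟩; positivity⟩
      (⟨_, W.starProjection_apply_mem (V.starProjection e)⟩ : W)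
  have h4 : ‖e - W.starProjection (V.starProjection e)‖ ≤ ‖e - V.starProjection e‖ +
      ‖V.starProjection e - W.starProjection (V.starProjection e)‖ :=
    norm_sub_le_norm_sub_add_norm_sub _ _ _
  have h5 : gap V W * ‖V.starProjection e‖ ≤ gap V W * ‖e‖ :=
    mul_le_mul_of_nonneg_left (V.norm_starProjection_apply_le e) (gap_nonneg _ _)
  linarith

/-- Between subspaces of equal dimension the gap is symmetric: when it is less than one, the
orthogonal projection of one subspace to the other is bijective. -/
theorem gap_le_gap_comm (h : Module.finrank ℝ U = Module.finrank ℝ V) : gap U V ≤ gap V U := by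
  rcases le_or_gt 1 (gap V U) with h1 | h1
  · exact (gap_le_one _ _).trans h1
  set α := gap V U with hα
  have hα0 : 0 ≤ α := gap_nonneg _ _
  -- restriction to `V` of the orthogonal projection to `U`
  let T : V →ₗ[ℝ] U := (U.orthogonalProjectionOnto : E →ₗ[ℝ] U) ∘ₗ V.subtype
  have hT : ∀ v : V, ((T v : U) : E) = U.starProjection v := fun v => rfl
  have hTinj : Function.Injective T := by
    rw [← LinearMap.ker_eq_bot, LinearMap.ker_eq_bot']
    intro v hv
    have h2 := norm_sub_starProjection_le_gap (V := U) v.2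
    rw [← hT, hv, Submodule.coe_zero, sub_zero] at h2
    have h3 : ‖(v : E)‖ = 0 := by nlinarith [norm_nonneg (v : E)]
    exact Subtype.ext (norm_eq_zero.1 h3)
  have hTsurj : Function.Surjective T :=
    (LinearMap.injective_iff_surjective_of_finrank_eq_finrank h.symm).1 hTinj
  refine gap_le_of_forall_norm_le hα0 fun u hu => ?_
  obtain ⟨v, hv⟩ := hTsurj ⟨u, hu⟩
  have huv : U.starProjection v = u := by rw [← hT, hv]
  have h2 := norm_sub_starProjection_le_gap (V := U) v.2
  rw [huv, ← hα] at h2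
  have horth : inner ℝ u ((v : E) - u) = 0 := by
    have := U.sub_starProjection_mem_orthogonal (v : E)
    rw [huv] at this
    exact Submodule.inner_right_of_mem_orthogonal hu this
  have hn : ‖(v : E)‖ ^ 2 = ‖u‖ ^ 2 + ‖(v : E) - u‖ ^ 2 := by
    have := norm_add_sq_real u ((v : E) - u)
    rw [horth, add_sub_cancel] at this
    linarith
  have hin : inner ℝ u (v : E) = ‖u‖ ^ 2 := by
    rw [inner_sub_right, sub_eq_zero, real_inner_self_eq_norm_sq] at horth
    exact horth
  have hPV : ‖u‖ ^ 2 ≤ ‖V.starProjection u‖ * ‖(v : E)‖ := by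
    rw [← hin]
    have : inner ℝ u (v : E) = inner ℝ (V.starProjection u) (v : E) := by
      rw [← sub_eq_zero, ← inner_sub_left]
      exact V.starProjection_inner_eq_zero _ _ v.2
    rw [this]
    exact real_inner_le_norm _ _
  have hpyth : ‖u‖ ^ 2 = ‖V.starProjection u‖ ^ 2 + ‖u - V.starProjection u‖ ^ 2 := by
    rw [← V.starProjection_orthogonal_val]
    exact Submodule.norm_sq_eq_add_norm_sq_starProjection u V
  have h3 : ‖(v : E) - u‖ ^ 2 ≤ α ^ 2 * ‖(v : E)‖ ^ 2 := by
    rw [← mul_pow]; gcongr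
  rcases (norm_nonneg u).eq_or_lt with h0 | h0
  · have : u = 0 := by rwa [eq_comm, norm_eq_zero] at h0
    simp [this]
  have hsq : ‖u‖ ^ 2 * ((1 - α ^ 2) * ‖u‖ ^ 2) ≤ ‖u‖ ^ 2 * ‖V.starProjection u‖ ^ 2 := by
    have h4 : (‖u‖ ^ 2) ^ 2 ≤ ‖V.starProjection u‖ ^ 2 * ‖(v : E)‖ ^ 2 := by
      rw [← mul_pow]; gcongr
    have h5 : 0 < 1 - α ^ 2 := by nlinarith
    have h6 : (1 - α ^ 2) * ‖(v : E)‖ ^ 2 ≤ ‖u‖ ^ 2 := by linarith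
    calc ‖u‖ ^ 2 * ((1 - α ^ 2) * ‖u‖ ^ 2) = (1 - α ^ 2) * (‖u‖ ^ 2) ^ 2 := by ring
      _ ≤ (1 - α ^ 2) * (‖V.starProjection u‖ ^ 2 * ‖(v : E)‖ ^ 2) := by gcongr
      _ = ‖V.starProjection u‖ ^ 2 * ((1 - α ^ 2) * ‖(v : E)‖ ^ 2) := by ring
      _ ≤ ‖V.starProjection u‖ ^ 2 * ‖u‖ ^ 2 := by gcongr
      _ = _ := by ring
  have h7 := le_of_mul_le_mul_left hsq (by positivity)
  refine le_of_sq_le_sq ?_ (by positivity)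
  rw [mul_pow]
  linarith

end Gap

/-- A function on `[0, 1]` that is `Λ`-Lipschitz at each point increases by at most `Λ`. -/
theorem sub_le_of_forall_eventually_abs_sub_le {G : ℝ → ℝ} {Λ : ℝ}
    (h : ∀ s ∈ Icc (0 : ℝ) 1, ∃ η > 0, ∀ s' ∈ Icc (0 : ℝ) 1, |s' - s| < η →
      |G s' - G s| ≤ Λ * |s' - s|) : G 1 - G 0 ≤ Λ := by
  have hG : ContinuousOn G (Icc 0 1) := by
    intro s hs
    obtain ⟨η, hη, H⟩ := h s hs
    rw [ContinuousWithinAt, tendsto_iff_norm_sub_tendsto_zero]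
    have hlim : Tendsto (fun s' : ℝ => Λ * |s' - s|) (𝓝[Icc 0 1] s) (𝓝 0) := by
      have : Continuous fun s' : ℝ => Λ * |s' - s| := by fun_prop
      simpa using (this.tendsto s).mono_left nhdsWithin_le_nhds
    refine squeeze_zero' (Eventually.of_forall fun _ => norm_nonneg _) ?_ hlim
    filter_upwards [self_mem_nhdsWithin, nhdsWithin_le_nhds (ball_mem_nhds s hη)] with s' h1 h2
    exact H s' h1 h2
  have hcl : IsClosed ({t : ℝ | G t ≤ G 0 + Λ * t} ∩ Icc 0 1) := by
    have := isClosed_Icc.isClosed_le hG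
      (show ContinuousOn (fun t : ℝ => G 0 + Λ * t) (Icc 0 1) by fun_prop)
    convert this using 1
    ext t; simp [and_comm]
  have := hcl.Icc_subset_of_forall_exists_gt (by simp) (fun s hs y hy => ?_)
    (right_mem_Icc.2 zero_le_one)
  · simp only [mem_ofPred_eq] at this; linarith
  · obtain ⟨hs1, hs0, hs2⟩ := hs
    obtain ⟨η, hη, H⟩ := h s ⟨hs0, hs2.le⟩
    have hy' : s < y := hy
    refine ⟨min (min y 1) (s + η / 2), ?_, lt_min (lt_min hy' hs2) (by linarith),
      (min_le_left _ _).trans (min_le_left _ _)⟩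
    set s' := min (min y 1) (s + η / 2) with hs'
    have h1 : s < s' := lt_min (lt_min hy' hs2) (by linarith)
    have h2 : s' ≤ s + η / 2 := min_le_right _ _
    have h3 := H s' ⟨by linarith, (min_le_left _ _).trans (min_le_right _ _)⟩
      (by rw [abs_of_pos (sub_pos.2 h1)]; linarith)
    rw [abs_of_pos (sub_pos.2 h1)] at h3
    have h4 := (le_abs_self _).trans h3
    simp only [mem_ofPred_eq] at hs1 ⊢
    linarith

end MetricLearning

namespace MetricLearning

/-! ### Tangent spaces of submanifolds of positive reach -/

section Tangent

variable {E : Type*} [NormedAddCommGroup E] [InnerProductSpace ℝ E] [FiniteDimensional ℝ E]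
  {M : Set E} {d k : ℕ} {r : ℝ}

/-- Federer's inequality: a submanifold of reach at least `r` does not meet the open balls of
radius `r` that are tangent to it. -/
theorem inner_le_of_mem_orthogonal_tangentSpace (hM : IsSubmanifoldOfClass d k M) (hk : 2 ≤ k)
    (hMc : IsCompact M) (hr : 0 < r) (hreach : ENNReal.ofReal r ≤ reach M) {p y w : E}
    (hp : p ∈ M) (hy : y ∈ M) (hw : w ∈ (tangentSpace M p)ᗮ) :
    inner ℝ (y - p) w ≤ ‖w‖ * ‖y - p‖ ^ 2 / (2 * r) := by
  have : ProperSpace E := FiniteDimensional.proper_real E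
  rcases (norm_nonneg w).eq_or_lt with h0 | h0
  · have : w = 0 := by rwa [eq_comm, norm_eq_zero] at h0
    simp [this]
  obtain ⟨-, C, η, hC, hη, -, hloc⟩ := hM.exists_local hk hp
  -- a distance small enough for the local graph structure to keep `M` out of the tangent ball
  set s : ℝ := min (min (η / 2) (1 / (2 * C))) (r / 2) with hs
  have hs0 : 0 < s := by positivity
  have hsη : s ≤ η / 2 := (min_le_left _ _).trans (min_le_left _ _)
  have hsC : s ≤ 1 / (2 * C) := (min_le_left _ _).trans (min_le_right _ _)
  have hsr : s < r := (min_le_right _ _).trans_lt (by linarith)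
  set t : ℝ := s / ‖w‖ with ht
  have ht0 : 0 < t := by positivity
  have htw : t * ‖w‖ = s := div_mul_cancel₀ _ h0.ne'
  set x : E := p + t • w with hx
  have hxp : x - p = t • w := by rw [hx, add_sub_cancel_left]
  have hnxp : ‖x - p‖ = s := by rw [hxp, norm_smul, Real.norm_of_nonneg ht0.le, htw]
  have hnear : ∀ z ∈ M, s ≤ ‖x - z‖ := by
    intro z hz
    rcases lt_or_ge ‖z - p‖ η with h1 | h1
    · obtain ⟨e, he, hle⟩ := hloc z hz h1
      have h2 : inner ℝ (z - p) w ≤ C * ‖z - p‖ ^ 2 * ‖w‖ := by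
        have : inner ℝ (z - p) w = inner ℝ (z - p - e) w := by
          rw [inner_sub_left (z - p), Submodule.inner_right_of_mem_orthogonal he hw, sub_zero]
        rw [this]
        exact (real_inner_le_norm _ _).trans (by gcongr)
      have h3 : ‖x - z‖ ^ 2 = s ^ 2 - 2 * t * inner ℝ (z - p) w + ‖z - p‖ ^ 2 := by
        rw [show x - z = (x - p) - (z - p) by abel, norm_sub_sq_real, hnxp, hxp, inner_smul_left,
          real_inner_comm, conj_trivial]
        ring
      have h4 : 2 * t * inner ℝ (z - p) w ≤ ‖z - p‖ ^ 2 := by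
        calc 2 * t * inner ℝ (z - p) w ≤ 2 * t * (C * ‖z - p‖ ^ 2 * ‖w‖) := by gcongr
          _ = 2 * (t * ‖w‖) * C * ‖z - p‖ ^ 2 := by ring
          _ ≤ 2 * (1 / (2 * C)) * C * ‖z - p‖ ^ 2 := by rw [htw]; gcongr
          _ = ‖z - p‖ ^ 2 := by field_simp
      refine le_of_sq_le_sq ?_ (norm_nonneg _)
      linarith
    · have h2 : ‖z - p‖ ≤ ‖x - z‖ + ‖x - p‖ := by
        rw [norm_sub_rev x z]; exact norm_sub_le_norm_sub_add_norm_sub _ _ _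
      rw [hnxp] at h2
      linarith
  have hinf : dist x p = infDist x M := by
    refine le_antisymm ?_ (infDist_le_dist_of_mem hp)
    rw [dist_eq_norm, hnxp, le_infDist ⟨p, hp⟩]
    intro z hz
    rw [dist_eq_norm]; exact hnear z hz
  have := inner_le_of_dist_eq_infDist hMc hr hreach hp hinf (by
    rw [← hinf, dist_eq_norm, hnxp]; exact hsr) hy
  rw [hxp, inner_smul_right, norm_smul, Real.norm_of_nonneg ht0.le, mul_assoc,
    mul_div_assoc] at this
  exact le_of_mul_le_mul_left this ht0

/-- Federer's inequality applied to the normal component of `y - p`. -/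
theorem norm_sub_starProjection_tangentSpace_le (hM : IsSubmanifoldOfClass d k M) (hk : 2 ≤ k)
    (hMc : IsCompact M) (hr : 0 < r) (hreach : ENNReal.ofReal r ≤ reach M) {p y : E}
    (hp : p ∈ M) (hy : y ∈ M) :
    ‖(y - p) - (tangentSpace M p).starProjection (y - p)‖ ≤ ‖y - p‖ ^ 2 / (2 * r) := by
  set w := (y - p) - (tangentSpace M p).starProjection (y - p) with hw
  have hwT : w ∈ (tangentSpace M p)ᗮ := Submodule.sub_starProjection_mem_orthogonal _
  have h := inner_le_of_mem_orthogonal_tangentSpace hM hk hMc hr hreach hp hy hwT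
  have h2 : inner ℝ (y - p) w = ‖w‖ ^ 2 := by
    rw [← real_inner_self_eq_norm_sq]
    nth_rewrite 2 [hw]
    rw [inner_sub_left (y - p), Submodule.inner_right_of_mem_orthogonal
      (Submodule.starProjection_apply_mem _ _) hwT, sub_zero]
  rcases (norm_nonneg w).eq_or_lt with h0 | h0
  · rw [← h0]; positivity
  rw [h2, sq, mul_div_assoc] at h
  exact le_of_mul_le_mul_left h h0

/-- Tangent spaces of a submanifold of reach at least `r` vary at rate `O(1 / r)`. The neighbourhood
depends on `M`, but the rate does not. -/
theorem exists_gap_tangentSpace_le (hM : IsSubmanifoldOfClass d k M) (hk : 2 ≤ k)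
    (hMc : IsCompact M) (hr : 0 < r) (hreach : ENNReal.ofReal r ≤ reach M) {p : E} (hp : p ∈ M) :
    ∃ η > 0, ∀ x ∈ M, ‖x - p‖ < η →
      gap (tangentSpace M p) (tangentSpace M x) ≤ 3 / r * ‖x - p‖ := by
  obtain ⟨-, C, η, hC, hη, hloc, -⟩ := hM.exists_local hk hp
  -- `1 / (20 * C)` makes the second-order error of the local graph negligible: without it the rate
  -- below would be `5 / 2`, and `3` leaves room for the error
  refine ⟨min η (1 / (20 * C)), by positivity, fun x hx hxp => ?_⟩
  set δ := ‖x - p‖ with hδ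
  rcases (norm_nonneg (x - p)).eq_or_lt with h0 | h0
  · have : x = p := by rwa [eq_comm, norm_eq_zero, sub_eq_zero] at h0
    rw [this, gap_self]; positivity
  rw [← hδ] at h0
  set T := tangentSpace M p with hT
  set g := gap T (tangentSpace M x) with hg
  have hg0 : 0 ≤ g := gap_nonneg _ _
  have hδη : δ < η := hxp.trans_le (min_le_left _ _)
  have hδC : C * δ ≤ 1 / 20 := by
    have := hxp.le.trans (min_le_right _ _)
    calc C * δ ≤ C * (1 / (20 * C)) := by gcongr
      _ = 1 / 20 := by field_simp
  -- comparison of `M` with its tangent space at `p` in a direction `e`, seen from `x`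
  have side : ∀ e ∈ T, ‖e‖ = 1 → ∀ w ∈ (tangentSpace M x)ᗮ, ‖w‖ = 1 →
      δ * inner ℝ e w + inner ℝ (p - x) w ≤
        (2 * δ + C * δ ^ 2) ^ 2 / (2 * r) + (δ + C * δ ^ 2) ^ 2 / (2 * r) + g * (C * δ ^ 2) := by
    intro e he he1 w hw hw1
    have hne : ‖δ • e‖ = δ := by rw [norm_smul, he1, mul_one, Real.norm_of_nonneg h0.le]
    obtain ⟨y, hy, hyp⟩ := hloc (δ • e) (T.smul_mem _ he) (by rwa [hne])
    rw [hne] at hyp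
    have h1 := inner_le_of_mem_orthogonal_tangentSpace hM hk hMc hr hreach hx hy hw
    have h2 := norm_sub_starProjection_tangentSpace_le hM hk hMc hr hreach hp hy
    rw [← hT] at h2
    set ρ := y - (p + δ • e) with hρ
    have hyp' : ‖y - p‖ ≤ δ + C * δ ^ 2 := by
      calc ‖y - p‖ = ‖δ • e + ρ‖ := by rw [hρ]; congr 1; abel
        _ ≤ ‖δ • e‖ + ‖ρ‖ := norm_add_le _ _
        _ ≤ _ := by rw [hne]; gcongr
    have hyx : ‖y - x‖ ≤ 2 * δ + C * δ ^ 2 := by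
      calc ‖y - x‖ ≤ ‖y - p‖ + ‖p - x‖ := norm_sub_le_norm_sub_add_norm_sub _ _ _
        _ ≤ (δ + C * δ ^ 2) + δ := by rw [norm_sub_rev p x]; gcongr
        _ = _ := by ring
    have h3 : ‖ρ - T.starProjection ρ‖ ≤ (δ + C * δ ^ 2) ^ 2 / (2 * r) := by
      have : ρ - T.starProjection ρ = (y - p) - T.starProjection (y - p) := by
        rw [hρ, ← sub_sub, map_sub T.starProjection (y - p),
          Submodule.starProjection_eq_self_iff.2 (T.smul_mem δ he)]
        abel
      rw [this]
      exact h2.trans (by gcongr)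
    have h4 : -inner ℝ (T.starProjection ρ) w ≤ g * (C * δ ^ 2) := by
      rw [← inner_neg_left]
      refine (inner_le_gap (T.neg_mem (T.starProjection_apply_mem ρ)) hw).trans ?_
      rw [hw1, mul_one, norm_neg]
      gcongr
      exact (T.norm_starProjection_apply_le ρ).trans hyp
    have h5 : -inner ℝ (ρ - T.starProjection ρ) w ≤ (δ + C * δ ^ 2) ^ 2 / (2 * r) := by
      rw [← inner_neg_left]
      refine (real_inner_le_norm _ _).trans ?_
      rw [hw1, mul_one, norm_neg]
      exact h3
    have h6 : inner ℝ (y - x) w ≤ (2 * δ + C * δ ^ 2) ^ 2 / (2 * r) := by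
      refine h1.trans ?_
      rw [hw1, one_mul]
      gcongr
    have h7 : δ * inner ℝ e w + inner ℝ (p - x) w = inner ℝ (y - x) w
        - inner ℝ (T.starProjection ρ) w - inner ℝ (ρ - T.starProjection ρ) w := by
      rw [← real_inner_smul_left, ← inner_add_left, ← inner_sub_left, ← inner_sub_left]
      congr 1
      rw [hρ]; abel
    linarith
  -- adding the bounds for `(e, w)` and `(-e, -w)` cancels the term `⟪p - x, w⟫`; the gap `g` on the
  -- right-hand side has a small coefficient and is absorbed afterwards
  have hb : g ≤ δ / (2 * r) * ((2 + C * δ) ^ 2 + (1 + C * δ) ^ 2) + g * (C * δ) := by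
    refine gap_le_of_forall_inner_le (by positivity) fun e he w hw he1 hw1 => ?_
    have s1 := side e he he1 w hw hw1
    have s2 := side (-e) (T.neg_mem he) (by rwa [norm_neg]) (-w)
      ((tangentSpace M x)ᗮ.neg_mem hw) (by rwa [norm_neg])
    rw [inner_neg_neg, inner_neg_right] at s2
    refine le_of_mul_le_mul_left ?_ h0
    have : δ * (δ / (2 * r) * ((2 + C * δ) ^ 2 + (1 + C * δ) ^ 2) + g * (C * δ)) =
        (2 * δ + C * δ ^ 2) ^ 2 / (2 * r) + (δ + C * δ ^ 2) ^ 2 / (2 * r) + g * (C * δ ^ 2) := by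
      field_simp
    rw [this]
    linarith
  have hCδ : 0 ≤ C * δ := by positivity
  have h1 : (2 + C * δ) ^ 2 + (1 + C * δ) ^ 2 ≤ 5.4 := by nlinarith
  have h2 : g * (C * δ) ≤ g * (1 / 20) := by gcongr
  have h3 : δ / (2 * r) * ((2 + C * δ) ^ 2 + (1 + C * δ) ^ 2) ≤ δ / (2 * r) * 5.4 := by gcongr
  have h4 : 3 / r * δ = δ / (2 * r) * 6 := by field_simp; norm_num
  have h5 : 0 ≤ δ / (2 * r) := by positivity
  rw [h4]
  linarith

/-- At distance at most `r / 4` tangent spaces are transverse to normal spaces: the local rate of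
`exists_gap_tangentSpace_le` is integrated along the nearest-point projection of a segment. -/
theorem gap_tangentSpace_lt_one (hM : IsSubmanifoldOfClass d k M) (hk : 2 ≤ k)
    (hMc : IsCompact M) (hr : 0 < r) (hreach : ENNReal.ofReal r ≤ reach M) {p x : E}
    (hp : p ∈ M) (hx : x ∈ M) (hxp : ‖x - p‖ ≤ r / 4) :
    gap (tangentSpace M p) (tangentSpace M x) < 1 := by
  have : ProperSpace E := FiniteDimensional.proper_real E
  obtain ⟨f, hf, hfix, hlip⟩ := exists_nearestPoint_map hMc ⟨p, hp⟩ hr hreach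
  -- each point of the segment from `p` to `x` is at distance at most `r / 8` of an endpoint
  have hLip := hlip (r / 8) (by linarith)
  have hconst : (1 - r / 8 / r)⁻¹ = 8 / 7 := by field_simp; norm_num
  rw [hconst] at hLip
  let z : ℝ → E := fun s => p + s • (x - p)
  have hz : ∀ s ∈ Icc (0 : ℝ) 1, infDist (z s) M ≤ r / 8 := by
    intro s hs
    have hseg : z s ∈ segment ℝ p x := by
      rw [segment_eq_image']; exact ⟨s, hs, rfl⟩
    refine (infDist_le_of_mem_segment hp hx hseg).trans ?_
    rw [dist_comm, dist_eq_norm]; linarith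
  have hq : ∀ s ∈ Icc (0 : ℝ) 1, ∀ s' ∈ Icc (0 : ℝ) 1,
      ‖f (z s') - f (z s)‖ ≤ 8 / 7 * ‖x - p‖ * |s' - s| := by
    intro s hs s' hs'
    have := hLip.norm_sub_le (hz s' hs') (hz s hs)
    rw [Real.coe_toNNReal _ (by norm_num)] at this
    refine this.trans (le_of_eq ?_)
    rw [show z s' - z s = (s' - s) • (x - p) by simp only [z]; rw [sub_smul]; abel, norm_smul,
      Real.norm_eq_abs]
    ring
  have hdim : ∀ a ∈ M, ∀ b ∈ M,
      Module.finrank ℝ (tangentSpace M a) = Module.finrank ℝ (tangentSpace M b) := by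
    intro a ha b hb
    rw [(hM.exists_local hk ha).1, (hM.exists_local hk hb).1]
  have key := sub_le_of_forall_eventually_abs_sub_le
    (G := fun s => gap (tangentSpace M p) (tangentSpace M (f (z s))))
    (Λ := 3 / r * (8 / 7 * ‖x - p‖)) (fun s hs => ?_)
  · simp only [z, one_smul, zero_smul, add_zero, add_sub_cancel, hfix x hx, hfix p hp,
      gap_self, sub_zero] at key
    refine key.trans_lt ?_
    calc 3 / r * (8 / 7 * ‖x - p‖) ≤ 3 / r * (8 / 7 * (r / 4)) := by gcongr
      _ = 6 / 7 := by field_simp; norm_num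
      _ < 1 := by norm_num
  · obtain ⟨η, hη, H⟩ := exists_gap_tangentSpace_le hM hk hMc hr hreach (hf (z s))
    have hD : 0 < 8 / 7 * ‖x - p‖ + 1 := by positivity
    refine ⟨η / (8 / 7 * ‖x - p‖ + 1), by positivity, fun s' hs' hss => ?_⟩
    have h1 := hq s hs s' hs'
    rw [lt_div_iff₀ hD] at hss
    have h2 := H (f (z s')) (hf _) (by nlinarith [abs_nonneg (s' - s)])
    have h3 : 3 / r * ‖f (z s') - f (z s)‖ ≤ 3 / r * (8 / 7 * ‖x - p‖) * |s' - s| := by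
      rw [mul_assoc (3 / r)]; gcongr
    have h4 := gap_triangle (tangentSpace M p) (tangentSpace M (f (z s)))
      (tangentSpace M (f (z s')))
    have h5 := gap_triangle (tangentSpace M p) (tangentSpace M (f (z s')))
      (tangentSpace M (f (z s)))
    have h6 := gap_le_gap_comm (hdim _ (hf (z s')) _ (hf (z s)))
    rw [abs_le]
    constructor <;> linarith

/-- First-order condition: at a local minimum on `M`, the derivative vanishes on the tangent
space. -/
theorem apply_tangent_eq_zero_of_isLocalMinOn (hM : IsSubmanifoldOfClass d k M)
    (hk : 2 ≤ k) {x e : E} (hx : x ∈ M) {f : E → ℝ} {f' : E →L[ℝ] ℝ} (hf : HasFDerivAt f f' x)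
    (hmin : IsLocalMinOn f M x) (he : e ∈ tangentSpace M x) : f' e = 0 := by
  obtain ⟨-, C, η, hC, hη, hloc, -⟩ := hM.exists_local hk hx
  have hc : ∀ t : ℝ, ∃ y, (‖t • e‖ < η → y ∈ M) ∧ ‖y - (x + t • e)‖ ≤ C * ‖t • e‖ ^ 2 := by
    intro t
    by_cases h : ‖t • e‖ < η
    · obtain ⟨y, hy, hy'⟩ := hloc _ ((tangentSpace M x).smul_mem t he) h
      exact ⟨y, fun _ => hy, hy'⟩
    · exact ⟨x + t • e, fun h' => absurd h' h, by simp; positivity⟩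
  choose c hcM hcd using hc
  have hc0 : c 0 = x := by
    have := hcd 0
    simpa [sub_eq_zero] using this
  have hder : HasDerivAt c e 0 := by
    rw [hasDerivAt_iff_isLittleO_nhds_zero]
    refine Asymptotics.IsBigO.trans_isLittleO (g := fun t : ℝ => t ^ 2) ?_
      (Asymptotics.isLittleO_pow_id one_lt_two)
    refine Asymptotics.IsBigO.of_bound (C * ‖e‖ ^ 2) (Eventually.of_forall fun t => ?_)
    rw [zero_add, hc0, sub_sub]
    refine (hcd t).trans (le_of_eq ?_)
    rw [norm_smul, norm_pow]; ring
  have hcomp : HasDerivAt (f ∘ c) (f' e) 0 :=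
    HasFDerivAt.comp_hasDerivAt 0 (by rwa [hc0]) hder
  refine IsLocalMin.hasDerivAt_eq_zero ?_ hcomp
  have hsmall : ∀ᶠ t : ℝ in 𝓝 0, ‖t • e‖ < η := by
    have : Continuous fun t : ℝ => ‖t • e‖ := by fun_prop
    have := this.tendsto 0
    rw [zero_smul, norm_zero] at this
    exact this.eventually_lt_const hη
  have hmem : Tendsto c (𝓝 0) (𝓝[M] x) := by
    refine tendsto_nhdsWithin_iff.2 ⟨?_, hsmall.mono hcM⟩
    have := hder.continuousAt.tendsto
    rwa [hc0] at this
  have := hmem.eventually hmin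
  filter_upwards [this] with t ht
  simpa [hc0] using ht

end Tangent

end MetricLearning

namespace MetricLearning

/-! ### Volume of small balls -/

section Volume

variable {E : Type*} [NormedAddCommGroup E] [InnerProductSpace ℝ E] [FiniteDimensional ℝ E]
  {M : Set E} {d k : ℕ} {r : ℝ}

/-- Near a point `x` at distance at most `r / 4` of `p`, the projection of `M` to the tangent space
at `p` is bi-Lipschitz. -/
theorem exists_mul_norm_le_norm_starProjection (hM : IsSubmanifoldOfClass d k M) (hk : 2 ≤ k)
    (hMc : IsCompact M) (hr : 0 < r) (hreach : ENNReal.ofReal r ≤ reach M) {p x : E}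
    (hp : p ∈ M) (hx : x ∈ M) (hxp : ‖x - p‖ ≤ r / 4) :
    ∃ c θ : ℝ, 0 < c ∧ 0 < θ ∧ ∀ y ∈ M, ‖y - x‖ ≤ θ →
      c * ‖y - x‖ ≤ ‖(tangentSpace M p).starProjection (y - x)‖ := by
  have ha := gap_tangentSpace_lt_one hM hk hMc hr hreach hx hp (by rwa [norm_sub_rev])
  set T := tangentSpace M p
  set a := gap (tangentSpace M x) T
  refine ⟨(1 - a) / 2, r * (1 - a), by linarith, mul_pos hr (by linarith), fun y hy hyx => ?_⟩
  set u := y - x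
  set τ := (tangentSpace M x).starProjection u with hτ
  have hn : ‖u - τ‖ ≤ ‖u‖ ^ 2 / (2 * r) :=
    norm_sub_starProjection_tangentSpace_le hM hk hMc hr hreach hx hy
  have hτa : ‖τ - T.starProjection τ‖ ≤ a * ‖u‖ :=
    (norm_sub_starProjection_le_gap (Submodule.starProjection_apply_mem _ _)).trans
      (mul_le_mul_of_nonneg_left (Submodule.norm_starProjection_apply_le _ _) (gap_nonneg _ _))
  have hnn : ‖(u - τ) - T.starProjection (u - τ)‖ ≤ ‖u - τ‖ := by
    rw [← T.starProjection_orthogonal_val]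
    exact Submodule.norm_starProjection_apply_le _ _
  have h1 : ‖u‖ ≤ ‖T.starProjection u‖ + ‖τ - T.starProjection τ‖
      + ‖(u - τ) - T.starProjection (u - τ)‖ := by
    calc ‖u‖ = ‖T.starProjection u + (τ - T.starProjection τ)
          + ((u - τ) - T.starProjection (u - τ))‖ := by
          rw [map_sub T.starProjection u τ]; congr 1; abel
      _ ≤ _ := norm_add₃_le
  have h2 : ‖u‖ ^ 2 / (2 * r) ≤ (1 - a) / 2 * ‖u‖ := by
    rw [div_le_iff₀ (by positivity)]
    nlinarith [norm_nonneg u]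
  linarith

/-- The projection to the tangent space at `p` is an open map on the part of `M` at distance less
than `r / 4` of `p`, in the following radial form. -/
theorem exists_starProjection_eq_smul (hM : IsSubmanifoldOfClass d k M) (hk : 2 ≤ k)
    (hMc : IsCompact M) (hr : 0 < r) (hreach : ENNReal.ofReal r ≤ reach M) {p x v : E}
    (hp : p ∈ M) (hx : x ∈ M) (hxp : ‖x - p‖ < r / 4) (hv : v ∈ tangentSpace M p) {s : ℝ}
    (hs : (tangentSpace M p).starProjection (x - p) = s • v) :
    ∃ η > 0, ∀ s', |s' - s| < η →
      ∃ y ∈ M, ‖y - p‖ < r / 4 ∧ (tangentSpace M p).starProjection (y - p) = s' • v := by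
  have : ProperSpace E := FiniteDimensional.proper_real E
  obtain ⟨c, θ₀, hc, hθ₀, hlow⟩ :=
    exists_mul_norm_le_norm_starProjection hM hk hMc hr hreach hp hx hxp.le
  set T := tangentSpace M p with hT
  set θ := min θ₀ ((r / 4 - ‖x - p‖) / 2) with hθ
  have hθ0 : 0 < θ := lt_min hθ₀ (by linarith)
  have hθr : ‖x - p‖ + θ < r / 4 := by
    have : θ ≤ (r / 4 - ‖x - p‖) / 2 := min_le_right _ _
    linarith
  refine ⟨c * θ / (2 * (‖v‖ + 1)), by positivity, fun s' hs' => ?_⟩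
  have hsv : 2 * (|s' - s| * ‖v‖) < c * θ := by
    rw [lt_div_iff₀ (by positivity)] at hs'
    nlinarith [abs_nonneg (s' - s)]
  have hK : IsCompact (M ∩ closedBall x θ) := hMc.inter_right isClosed_closedBall
  obtain ⟨y, ⟨hyM, hyx⟩, hmin⟩ := hK.exists_isMinOn ⟨x, hx, mem_closedBall_self hθ0.le⟩
    (f := fun y => ‖T.starProjection (y - p) - s' • v‖ ^ 2) (by fun_prop)
  rw [mem_closedBall, dist_eq_norm] at hyx
  set w := T.starProjection (y - p) - s' • v with hw
  have hxs : T.starProjection (x - p) - s' • v = (s - s') • v := by rw [hs, sub_smul]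
  have hwx : ‖w‖ ≤ |s' - s| * ‖v‖ := by
    have : ‖w‖ ^ 2 ≤ ‖T.starProjection (x - p) - s' • v‖ ^ 2 :=
      hmin ⟨hx, mem_closedBall_self hθ0.le⟩
    rw [hxs, norm_smul, Real.norm_eq_abs, abs_sub_comm] at this
    exact le_of_sq_le_sq this (by positivity)
  have hyp : ‖y - p‖ < r / 4 :=
    (norm_sub_le_norm_sub_add_norm_sub y x p).trans_lt (by linarith)
  -- the lower bound on the projection keeps the minimizer away from the boundary of the ball
  have hint : ‖y - x‖ < θ := by
    refine lt_of_le_of_ne hyx fun heq => ?_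
    have h1 := hlow y hyM (hyx.trans (min_le_left _ _))
    rw [heq] at h1
    have h2 : T.starProjection (y - x) = w - (s - s') • v := by
      rw [← hxs, hw, sub_sub_sub_cancel_right, ← map_sub]; congr 1; abel
    rw [h2] at h1
    have h3 := norm_sub_le w ((s - s') • v)
    rw [norm_smul, Real.norm_eq_abs, abs_sub_comm] at h3
    linarith
  have hloc : IsLocalMinOn (fun y => ‖T.starProjection (y - p) - s' • v‖ ^ 2) M y := by
    have hb : ball x θ ∈ 𝓝 y := isOpen_ball.mem_nhds (by rwa [mem_ball, dist_eq_norm])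
    filter_upwards [self_mem_nhdsWithin, nhdsWithin_le_nhds hb] with z hz hzx
    exact hmin ⟨hz, ball_subset_closedBall hzx⟩
  have hder : HasFDerivAt (fun y => ‖T.starProjection (y - p) - s' • v‖ ^ 2)
      (2 • (innerSL ℝ w).comp T.starProjection) y := by
    have h0 : HasFDerivAt (fun y => T.starProjection (y - p) - s' • v) T.starProjection y :=
      (T.starProjection.hasFDerivAt.comp y ((hasFDerivAt_id y).sub_const p)).sub_const _
    exact h0.norm_sq
  have hwT : w ∈ T := T.sub_mem (T.starProjection_apply_mem _) (T.smul_mem _ hv)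
  have hwN : w ∈ (tangentSpace M y)ᗮ := by
    rw [Submodule.mem_orthogonal']
    intro e he
    have h0 := apply_tangent_eq_zero_of_isLocalMinOn hM hk hyM hder hloc he
    simp only [smul_apply, ContinuousLinearMap.comp_apply, innerSL_apply_apply,
      nsmul_eq_mul, Nat.cast_ofNat, mul_eq_zero, OfNat.ofNat_ne_zero, false_or] at h0
    rw [← h0, ← sub_eq_zero, ← inner_sub_right]
    exact Submodule.inner_right_of_mem_orthogonal hwT (T.sub_starProjection_mem_orthogonal e)
  have hg := inner_le_gap hwT hwN
  have hg1 := gap_tangentSpace_lt_one hM hk hMc hr hreach hp hyM hyp.le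
  rw [real_inner_self_eq_norm_sq, ← hT] at *
  have hw0 : ‖w‖ = 0 := by
    by_contra hne
    have : 0 < ‖w‖ ^ 2 := by positivity
    nlinarith
  exact ⟨y, hyM, hyp, sub_eq_zero.1 (norm_eq_zero.1 hw0)⟩

/-- The projection of `M ∩ B(p, r / 4)` to the tangent space at `p` covers a ball of radius
`(r / 4) √(1 - 1 / 8²)`. -/
theorem exists_starProjection_eq (hM : IsSubmanifoldOfClass d k M) (hk : 2 ≤ k)
    (hMc : IsCompact M) (hr : 0 < r) (hreach : ENNReal.ofReal r ≤ reach M) {p v : E}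
    (hp : p ∈ M) (hv : v ∈ tangentSpace M p) (hvr : ‖v‖ ^ 2 < (1 - 1 / 8 ^ 2) * (r / 4) ^ 2) :
    ∃ x ∈ M, ‖x - p‖ < r / 4 ∧ (tangentSpace M p).starProjection (x - p) = v := by
  have : ProperSpace E := FiniteDimensional.proper_real E
  set T := tangentSpace M p with hT
  -- the quadratic bound on the normal part prevents the lift from reaching the boundary
  have hstrict : ∀ s ∈ Icc (0 : ℝ) 1, ∀ x ∈ M, ‖x - p‖ ≤ r / 4 →
      T.starProjection (x - p) = s • v → ‖x - p‖ < r / 4 := by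
    intro s hs x hx hxr hxs
    refine lt_of_le_of_ne hxr fun heq => ?_
    have h1 := norm_sub_starProjection_tangentSpace_le hM hk hMc hr hreach hp hx
    have h2 := Submodule.norm_sq_eq_add_norm_sq_starProjection (x - p) T
    rw [T.starProjection_orthogonal_val, hxs] at h2
    rw [← hT, hxs, heq] at h1
    rw [heq, norm_smul, Real.norm_of_nonneg hs.1] at h2
    have h3 : (r / 4) ^ 2 / (2 * r) = r / 32 := by field_simp; norm_num
    rw [h3] at h1
    have h4 : ‖x - p - s • v‖ ^ 2 ≤ (r / 32) ^ 2 := by gcongr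
    have h5 : (s * ‖v‖) ^ 2 ≤ ‖v‖ ^ 2 := by
      have : s * ‖v‖ ≤ ‖v‖ := mul_le_of_le_one_left (norm_nonneg _) hs.2
      have := mul_nonneg hs.1 (norm_nonneg v)
      gcongr
    nlinarith
  let S : Set ℝ := {s | s • v ∈ (fun x => T.starProjection (x - p)) '' (M ∩ closedBall p (r / 4))}
  have hS : IsClosed S := by
    have hc : IsCompact ((fun x => T.starProjection (x - p)) '' (M ∩ closedBall p (r / 4))) :=
      (hMc.inter_right isClosed_closedBall).image (by fun_prop)
    exact hc.isClosed.preimage (by fun_prop : Continuous fun s : ℝ => s • v)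
  have h1S : (1 : ℝ) ∈ S := by
    refine (hS.inter isClosed_Icc).Icc_subset_of_forall_exists_gt ?_ (fun s hs y hy => ?_)
      (right_mem_Icc.2 zero_le_one)
    · exact ⟨p, ⟨hp, mem_closedBall_self (by positivity)⟩, by simp⟩
    · obtain ⟨⟨x, ⟨hx, hxr⟩, hxs⟩, hs0, hs1⟩ := hs
      rw [mem_closedBall, dist_eq_norm] at hxr
      obtain ⟨η, hη, H⟩ := exists_starProjection_eq_smul hM hk hMc hr hreach hp hx
        (hstrict s ⟨hs0, hs1.le⟩ x hx hxr hxs) hv hxs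
      have hy' : s < y := hy
      have hlt : s < min y (s + η / 2) := lt_min hy' (by linarith)
      obtain ⟨z, hz, hzr, hzs⟩ := H (min y (s + η / 2)) (by
        rw [abs_of_pos (sub_pos.2 hlt)]
        have : min y (s + η / 2) ≤ s + η / 2 := min_le_right _ _
        linarith)
      exact ⟨_, ⟨z, ⟨hz, by rw [mem_closedBall, dist_eq_norm]; exact hzr.le⟩, hzs⟩, hlt,
        min_le_left _ _⟩
  obtain ⟨x, ⟨hx, hxr⟩, hxs⟩ := h1S
  rw [mem_closedBall, dist_eq_norm] at hxr
  exact ⟨x, hx, hstrict 1 ⟨zero_le_one, le_rfl⟩ x hx hxr hxs, by simpa using hxs⟩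

theorem _root_.LipschitzWith.euclideanHausdorffMeasure_image_le {X Y : Type*} [EMetricSpace X]
    [EMetricSpace Y] [MeasurableSpace X] [BorelSpace X] [MeasurableSpace Y] [BorelSpace Y]
    {f : X → Y} (hf : LipschitzWith 1 f) (d : ℕ) (s : Set X) :
    (μHE[d] : Measure Y) (f '' s) ≤ (μHE[d] : Measure X) s := by
  simp only [Measure.euclideanHausdorffMeasure_def, Measure.smul_apply]
  gcongr
  simpa using hf.hausdorffMeasure_image_le (d := d) (Nat.cast_nonneg d) s

/-- The projection to the tangent space is `1`-Lipschitz and covers a `d`-dimensional ball. -/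
theorem le_euclideanHausdorffMeasure_inter_ball [MeasurableSpace E] [BorelSpace E]
    (hM : IsSubmanifoldOfClass d k M) (hk : 2 ≤ k) (hMc : IsCompact M) (hr : 0 < r)
    (hreach : ENNReal.ofReal r ≤ reach M) {p : E} (hp : p ∈ M) :
    ENNReal.ofReal ((√(1 - 1 / 8 ^ 2) * (r / 4)) ^ d * unitBallVolume d) ≤
      (μHE[d] : Measure E) (M ∩ ball p (r / 4)) := by
  set T := tangentSpace M p with hT
  have hd : Module.finrank ℝ T = d := (hM.exists_local hk hp).1
  let ι : T ≃ₗᵢ[ℝ] EuclideanSpace ℝ (Fin d) :=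
    ((stdOrthonormalBasis ℝ T).reindex (finCongr hd)).repr
  let g : E → EuclideanSpace ℝ (Fin d) := fun x => ι (T.orthogonalProjectionOnto (x - p))
  have hg : LipschitzWith 1 g := by
    refine LipschitzWith.of_dist_le_mul fun x y => ?_
    simp only [g]
    rw [ι.dist_map, dist_eq_norm, ← map_sub, sub_sub_sub_cancel_right, NNReal.coe_one, one_mul,
      dist_eq_norm]
    exact T.norm_orthogonalProjectionOnto_apply_le _
  set ρ := √(1 - 1 / 8 ^ 2) * (r / 4) with hρ
  have hρ0 : 0 < ρ := by
    have : (0 : ℝ) < 1 - 1 / 8 ^ 2 := by norm_num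
    positivity
  have hsub : ball (0 : EuclideanSpace ℝ (Fin d)) ρ ⊆ g '' (M ∩ ball p (r / 4)) := by
    intro w hw
    have hw' : ‖((ι.symm w : T) : E)‖ < ρ := by
      rw [← Submodule.coe_norm, ι.symm.norm_map]
      simpa using hw
    obtain ⟨x, hx, hxr, hxv⟩ := exists_starProjection_eq hM hk hMc hr hreach hp
      (ι.symm w).2 (by
        calc _ < ρ ^ 2 := by gcongr
          _ = _ := by rw [hρ, mul_pow, Real.sq_sqrt (by norm_num)])
    refine ⟨x, ⟨hx, by rwa [mem_ball, dist_eq_norm]⟩, ?_⟩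
    have : T.orthogonalProjectionOnto (x - p) = ι.symm w := Subtype.ext hxv
    simp only [g, this, ι.apply_symm_apply]
  refine le_trans ?_ ((measure_mono hsub).trans (hg.euclideanHausdorffMeasure_image_le d _))
  rw [EuclideanSpace.euclideanHausdorffMeasure_eq_volume,
    Measure.addHaar_ball_of_pos _ _ hρ0, finrank_euclideanSpace_fin,
    ENNReal.ofReal_mul (by positivity), unitBallVolume,
    ENNReal.ofReal_toReal measure_ball_lt_top.ne]

end Volume

end MetricLearning

namespace MetricLearning

/-! ### The intrinsic diameter -/

section Diameter

variable {D d k : ℕ} {r : ℝ} {L : ℕ → ℝ} {fmin fmax : ℝ} {P : Measure (Amb D)}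

theorem unitBallVolume_pos (d : ℕ) : 0 < unitBallVolume d :=
  ENNReal.toReal_pos (measure_ball_pos _ _ one_pos).ne' measure_ball_lt_top.ne

/-- The constant `dMax` is `r` divided by the lower bound for the mass of a ball of radius
`r / 4`. -/
theorem dMax_eq (d : ℕ) (hr : 0 < r) (hf : 0 < fmin) : dMax d r fmin =
    r / (fmin * ((√(1 - 1 / 8 ^ 2) * (r / 4)) ^ d * unitBallVolume d)) := by
  have h : (1 - 1 / 8 ^ 2 : ℝ) ^ ((d : ℝ) / 2) = √(1 - 1 / 8 ^ 2) ^ d := by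
    rw [Real.sqrt_eq_rpow, ← Real.rpow_mul_natCast (by norm_num)]
    congr 1; ring
  have hs : (0 : ℝ) < √(1 - 1 / 8 ^ 2) := Real.sqrt_pos.2 (by norm_num)
  have := unitBallVolume_pos d
  rw [dMax, h, mul_pow, div_pow]
  field_simp

/-- The volume bound and the density bound make every ball of radius `r / 4` charge at least the
reciprocal of `dMax / r`. -/
theorem IsModelDistribution.le_measure_ball (hP : IsModelDistribution d k r L fmin fmax P)
    (hk : 2 ≤ k) (hr : 0 < r) (hf : 0 < fmin) {p : Amb D} (hp : p ∈ P.support) :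
    ENNReal.ofReal (fmin * ((√(1 - 1 / 8 ^ 2) * (r / 4)) ^ d * unitBallVolume d)) ≤
      P (ball p (r / 4)) := by
  have hM := hP.support
  obtain ⟨f, -, hfb, hPf⟩ := hP.density
  have hv := le_euclideanHausdorffMeasure_inter_ball hM.submanifold hk hM.isCompact hr
    hM.le_reach hp
  have h1 : P (ball p (r / 4)) = ∫⁻ x in P.support ∩ ball p (r / 4), f x ∂(μHE[d]) := by
    conv_lhs => rw [hPf]
    rw [withDensity_apply _ measurableSet_ball, Measure.restrict_restrict measurableSet_ball,
      inter_comm]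
  rw [h1, ENNReal.ofReal_mul hf.le]
  calc _ ≤ ENNReal.ofReal fmin * (μHE[d] : Measure (Amb D)) (P.support ∩ ball p (r / 4)) := by
        gcongr
    _ = ∫⁻ _ in P.support ∩ ball p (r / 4), ENNReal.ofReal fmin ∂(μHE[d]) := by
        rw [setLIntegral_const]
    _ ≤ _ := setLIntegral_mono' (hM.isCompact.measurableSet.inter measurableSet_ball)
        fun x hx => (hfb x hx.1).1

/-- A packing bound: `r / 2`-separated points of the support are at most `dMax / r` many. -/
theorem IsModelDistribution.card_mul_le_dMax (hP : IsModelDistribution d k r L fmin fmax P)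
    (hk : 2 ≤ k) (hr : 0 < r) (hf : 0 < fmin) {N : ℕ} {z : Fin N → Amb D}
    (hz : ∀ i, z i ∈ P.support) (hsep : ∀ i j, i ≠ j → r / 2 ≤ dist (z i) (z j)) :
    N * r ≤ dMax d r fmin := by
  have := hP.isProbabilityMeasure
  set v := fmin * ((√(1 - 1 / 8 ^ 2) * (r / 4)) ^ d * unitBallVolume d) with hv
  have hv0 : 0 < v := by
    have hs : (0 : ℝ) < √(1 - 1 / 8 ^ 2) := Real.sqrt_pos.2 (by norm_num)
    have := unitBallVolume_pos d
    positivity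
  have hdisj : Pairwise (Function.onFun Disjoint fun i => ball (z i) (r / 4)) := fun i j hij =>
    ball_disjoint_ball (by linarith [hsep i j hij])
  have h1 : ENNReal.ofReal (N * v) ≤ ENNReal.ofReal 1 := by
    calc ENNReal.ofReal (N * v) = ∑ _i : Fin N, ENNReal.ofReal v := by
          simp [ENNReal.ofReal_mul]
      _ ≤ ∑ i, P (ball (z i) (r / 4)) :=
          Finset.sum_le_sum fun i _ => hP.le_measure_ball hk hr hf (hz i)
      _ = P (⋃ i, ball (z i) (r / 4)) := by
          rw [measure_iUnion hdisj fun i => measurableSet_ball, tsum_fintype]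
      _ ≤ ENNReal.ofReal 1 := by simpa using prob_le_one
  rw [ENNReal.ofReal_le_ofReal_iff zero_le_one] at h1
  rw [dMax_eq d hr hf, ← hv, le_div_iff₀ hv0]
  nlinarith

/-- Points at intrinsic distances `0, r, 2r, …` from `x` exist by connectedness and are
`r / 2`-separated, so the packing bound limits the intrinsic diameter. -/
theorem IsModelDistribution.geodesicDist_le (hP : IsModelDistribution d k r L fmin fmax P)
    (hk : 2 ≤ k) (hr : 0 < r) (hf : 0 < fmin) {x y : Amb D} (hx : x ∈ P.support)
    (hy : y ∈ P.support) : geodesicDist P.support x y ≤ ENNReal.ofReal (dMax d r fmin) := by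
  have hM := hP.support
  set M := P.support with hMdef
  -- truncation keeps the intrinsic distance to `x` real-valued before it is known to be finite
  have key : ∀ C : ℝ, (min (geodesicDist M x y) (ENNReal.ofReal C)).toReal ≤ dMax d r fmin := by
    intro C
    set h : Amb D → ℝ := fun z => (min (geodesicDist M x z) (ENNReal.ofReal C)).toReal with hh
    have htri : ∀ z z' : Amb D, ∀ c : ℝ, 0 ≤ c → geodesicDist M z' z ≤ ENNReal.ofReal c →
        h z ≤ h z' + c := by
      intro z z' c hc hzz
      have h1 : min (geodesicDist M x z) (ENNReal.ofReal C) ≤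
          min (geodesicDist M x z') (ENNReal.ofReal C) + ENNReal.ofReal c := by
        rw [min_add]
        exact min_le_min ((geodesicDist_triangle M x z' z).trans (by gcongr)) le_self_add
      have h2 : min (geodesicDist M x z') (ENNReal.ofReal C) ≠ ⊤ :=
        ne_top_of_le_ne_top ENNReal.ofReal_ne_top (min_le_right _ _)
      have h3 := ENNReal.toReal_mono (by simp [h2]) h1
      rwa [ENNReal.toReal_add h2 ENNReal.ofReal_ne_top, ENNReal.toReal_ofReal hc] at h3
    have hcont : ContinuousOn h M := by
      intro z hz
      rw [ContinuousWithinAt, tendsto_iff_norm_sub_tendsto_zero]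
      have hlim : Tendsto (fun z' : Amb D => 2 * dist z' z) (𝓝[M] z) (𝓝 0) := by
        have : Continuous fun z' : Amb D => 2 * dist z' z := by fun_prop
        simpa using (this.tendsto z).mono_left nhdsWithin_le_nhds
      refine squeeze_zero' (Eventually.of_forall fun _ => norm_nonneg _) ?_ hlim
      filter_upwards [self_mem_nhdsWithin, nhdsWithin_le_nhds (ball_mem_nhds z hr)] with z' hz' hzr
      have hhalf : (1 - r / 2 / r)⁻¹ = 2 := by field_simp; norm_num
      have h1 := geodesicDist_le_mul_edist hM.isCompact hr hM.le_reach (m := r / 2) (by linarith)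
        hz' hz (by rw [mem_ball] at hzr; linarith)
      have h2 := geodesicDist_le_mul_edist hM.isCompact hr hM.le_reach (m := r / 2) (by linarith)
        hz hz' (by rw [mem_ball, dist_comm] at hzr; linarith)
      rw [hhalf] at h1 h2
      have h3 := htri _ _ _ (by positivity) h1
      have h4 := htri _ _ _ (by positivity) h2
      rw [dist_comm z z'] at h4
      rw [Real.norm_eq_abs, abs_le]
      constructor <;> linarith
    have hx0 : h x = 0 := by
      have : geodesicDist M x x = 0 := le_antisymm
        ((geodesicDist_le_of_segment_subset (K := M) (by simpa using hx)).trans (by simp)) (zero_le)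
      simp [hh, this]
    set ℓ := h y with hℓ
    have hℓ0 : 0 ≤ ℓ := ENNReal.toReal_nonneg
    -- the number of multiples of `r` in `[0, ℓ]`, zero included
    set N := ⌊ℓ / r⌋₊ + 1 with hN
    have hiv : ∀ i : Fin N, ∃ z ∈ M, h z = i * r := by
      intro i
      refine hM.isConnected.isPreconnected.intermediate_value hx hy hcont ⟨?_, ?_⟩
      · rw [hx0]; positivity
      · have h1 : (i : ℕ) ≤ ⌊ℓ / r⌋₊ := Nat.lt_succ_iff.1 i.2
        rwa [Nat.le_floor_iff (by positivity), le_div_iff₀ hr] at h1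
    choose z hzM hz using hiv
    have hsep : ∀ i j, i ≠ j → r / 2 ≤ dist (z i) (z j) := by
      have hlt : ∀ i j : Fin N, i < j → r / 2 ≤ dist (z i) (z j) := by
        intro i j hij
        by_contra! hd
        have hq : (1 - r / 4 / r)⁻¹ = 4 / 3 := by field_simp; norm_num
        have h1 := geodesicDist_le_mul_edist hM.isCompact hr hM.le_reach (m := r / 4)
          (by linarith) (hzM i) (hzM j) (by linarith)
        rw [hq] at h1
        have h2 := htri _ _ _ (by positivity) h1
        rw [hz, hz] at h2
        have h3 : ((i : ℕ) : ℝ) + 1 ≤ ((j : ℕ) : ℝ) := by exact_mod_cast hij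
        nlinarith
      intro i j hij
      rcases lt_or_gt_of_ne hij with h | h
      · exact hlt i j h
      · rw [dist_comm]; exact hlt j i h
    have hcard := hP.card_mul_le_dMax hk hr hf hzM hsep
    refine le_trans ?_ hcard
    have := (Nat.lt_floor_add_one (ℓ / r)).le
    rw [div_le_iff₀ hr] at this
    rw [hN]; push_cast; exact this
  by_contra! hlt
  have hpos : 0 ≤ dMax d r fmin := ENNReal.toReal_nonneg.trans (key 0)
  have h1 := key (dMax d r fmin + 1)
  have h2 : ENNReal.ofReal (dMax d r fmin) <
      min (geodesicDist M x y) (ENNReal.ofReal (dMax d r fmin + 1)) :=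
    lt_min hlt ((ENNReal.ofReal_lt_ofReal_iff (by linarith)).2 (by linarith))
  rw [ENNReal.ofReal_lt_iff_lt_toReal hpos
    (ne_top_of_le_ne_top ENNReal.ofReal_ne_top (min_le_right _ _))] at h2
  linarith

end Diameter

/-! ### The plug-in estimator -/

section PlugIn

variable {D : ℕ} {M S : Set (Amb D)} {r ε Δ : ℝ}

theorem lossInf_le {d' : Amb D → Amb D → ℝ} {c : ℝ}
    (h : ∀ x ∈ M, ∀ y ∈ M, x ≠ y → |1 - d' x y / (geodesicDist M x y).toReal| ≤ c) :
    lossInf M d' ≤ ENNReal.ofReal c :=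
  iSup₂_le fun x hx => iSup₂_le fun y hy => iSup_le fun hxy =>
    ENNReal.ofReal_le_ofReal (h x hx y hy hxy)

theorem dist_le_toReal_geodesicDist {x y : Amb D} (hfin : geodesicDist M x y ≠ ⊤) :
    dist x y ≤ (geodesicDist M x y).toReal := by
  rw [dist_edist]
  exact ENNReal.toReal_mono hfin (edist_le_geodesicDist M x y)

theorem plugInDist_le_of_geodesicDist_le {x y : Amb D} {c : ℝ} (hc : 0 ≤ c)
    (h : geodesicDist (cthickening ε (S ∪ {x, y})) x y ≤ ENNReal.ofReal c) :
    plugInDist S ε Δ x y ≤ c := by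
  have := ENNReal.toReal_mono ENNReal.ofReal_ne_top ((min_le_left _ (ENNReal.ofReal Δ)).trans h)
  rwa [ENNReal.toReal_ofReal hc] at this

theorem plugInDist_le {x y : Amb D} (hΔ : 0 ≤ Δ) : plugInDist S ε Δ x y ≤ Δ := by
  have := ENNReal.toReal_mono ENNReal.ofReal_ne_top
    (min_le_right (geodesicDist (cthickening ε (S ∪ {x, y})) x y) (ENNReal.ofReal Δ))
  rwa [ENNReal.toReal_ofReal hΔ] at this

/-- Whatever the estimator `S`, the loss is at most `1 + Δ / ε`: points at distance at most `ε` are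
joined by a segment in the offset of `{x, y}`, and other distances are truncated at `Δ`. -/
theorem lossInf_plugInDist_le (hε : 0 < ε)
    (hdiam : ∀ x ∈ M, ∀ y ∈ M, geodesicDist M x y ≤ ENNReal.ofReal Δ) :
    lossInf M (plugInDist S ε Δ) ≤ ENNReal.ofReal (1 + Δ / ε) := by
  refine lossInf_le fun x hx y hy hxy => ?_
  have hfin : geodesicDist M x y ≠ ⊤ := ne_top_of_le_ne_top ENNReal.ofReal_ne_top (hdiam x hx y hy)
  have hle := dist_le_toReal_geodesicDist hfin
  have hpos : 0 < (geodesicDist M x y).toReal := (dist_pos.2 hxy).trans_le hle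
  have hΔ : 0 < Δ := by
    by_contra! h
    have := hdiam x hx y hy
    rw [ENNReal.ofReal_of_nonpos h, nonpos_iff_eq_zero] at this
    rw [this] at hpos
    simp at hpos
  set dM := (geodesicDist M x y).toReal
  have h0 : 0 ≤ plugInDist S ε Δ x y / dM := div_nonneg ENNReal.toReal_nonneg hpos.le
  have hub : plugInDist S ε Δ x y / dM ≤ 1 + Δ / ε := by
    rcases le_total (dist x y) ε with h | h
    · have hseg : segment ℝ x y ⊆ cthickening ε (S ∪ {x, y}) := by
        intro z hz
        have h1 : dist x z + dist z y = dist x y := dist_add_dist_of_mem_segment hz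
        refine mem_cthickening_of_dist_le z x ε _ (by simp) ?_
        rw [dist_comm]
        linarith [dist_nonneg (x := z) (y := y)]
      have h1 : plugInDist S ε Δ x y ≤ dist x y := plugInDist_le_of_geodesicDist_le dist_nonneg
        ((geodesicDist_le_of_segment_subset hseg).trans (edist_dist x y).le)
      have h2 : plugInDist S ε Δ x y / dM ≤ 1 := by
        rw [div_le_one hpos]; exact h1.trans hle
      have : 0 ≤ Δ / ε := by positivity
      linarith
    · have h2 : plugInDist S ε Δ x y / dM ≤ Δ / ε :=
        div_le_div₀ hΔ.le (plugInDist_le hΔ.le) hε (h.trans hle)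
      linarith
  have : 0 ≤ Δ / ε := by positivity
  rw [abs_le]
  constructor <;> linarith

/-- If `S` is `ε`-close to `M`, then `M` is contained in the offset, which is contained in the
`2ε`-offset of `M`; the nearest-point map of the latter controls the loss. -/
theorem lossInf_plugInDist_le_of_hausdorffEDist_le (hM : IsCompact M) (hr : 0 < r)
    (hreach : ENNReal.ofReal r ≤ reach M) (hε : 0 < ε)
    (hdiam : ∀ x ∈ M, ∀ y ∈ M, geodesicDist M x y ≤ ENNReal.ofReal Δ)
    (hS : hausdorffEDist S M ≤ ENNReal.ofReal ε) :
    lossInf M (plugInDist S ε Δ) ≤ ENNReal.ofReal (2 * ε / r) := by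
  refine lossInf_le fun x hx y hy hxy => ?_
  have hfin : geodesicDist M x y ≠ ⊤ := ne_top_of_le_ne_top ENNReal.ofReal_ne_top (hdiam x hx y hy)
  have hpos : 0 < (geodesicDist M x y).toReal :=
    (dist_pos.2 hxy).trans_le (dist_le_toReal_geodesicDist hfin)
  set K := cthickening ε (S ∪ {x, y}) with hK
  have hMK : M ⊆ K := by
    intro z hz
    rw [hK, mem_cthickening_iff]
    refine (infEDist_anti subset_union_left).trans ?_
    rw [hausdorffEDist_comm] at hS
    exact (infEDist_le_hausdorffEDist_of_mem hz).trans hS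
  have hKM : ∀ z ∈ K, infDist z M ≤ 2 * ε := by
    intro z hz
    rw [hK, mem_cthickening_iff] at hz
    have h1 : infEDist z M ≤ infEDist z (S ∪ {x, y}) + hausdorffEDist (S ∪ {x, y}) M :=
      infEDist_le_infEDist_add_hausdorffEDist
    have h2 : hausdorffEDist (S ∪ {x, y}) M ≤ ENNReal.ofReal ε := by
      refine hausdorffEDist_le_of_infEDist ?_ ?_
      · rintro w (hw | hw | hw)
        · exact (infEDist_le_hausdorffEDist_of_mem hw).trans hS
        · rw [hw, infEDist_zero_of_mem hx]; exact zero_le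
        · rw [mem_singleton_iff.1 hw, infEDist_zero_of_mem hy]; exact zero_le
      · intro w hw
        refine (infEDist_anti subset_union_left).trans ?_
        rw [hausdorffEDist_comm] at hS
        exact (infEDist_le_hausdorffEDist_of_mem hw).trans hS
    have h3 : infEDist z M ≤ ENNReal.ofReal (2 * ε) := by
      rw [two_mul, ENNReal.ofReal_add hε.le hε.le]
      exact h1.trans (add_le_add hz h2)
    have := ENNReal.toReal_mono ENNReal.ofReal_ne_top h3
    rwa [ENNReal.toReal_ofReal (by positivity)] at this
  set dM := (geodesicDist M x y).toReal with hdM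
  have hdMe : ENNReal.ofReal dM = geodesicDist M x y := ENNReal.ofReal_toReal hfin
  have h0 : 0 ≤ plugInDist S ε Δ x y / dM := div_nonneg ENNReal.toReal_nonneg hpos.le
  have hub : plugInDist S ε Δ x y / dM ≤ 1 := by
    rw [div_le_one hpos]
    exact plugInDist_le_of_geodesicDist_le hpos.le (by
      rw [hdMe]; exact geodesicDist_mono hMK x y)
  have hlb : 1 - 2 * ε / r ≤ plugInDist S ε Δ x y / dM := by
    rcases le_or_gt r (2 * ε) with h | h
    · have : 1 ≤ 2 * ε / r := by rwa [le_div_iff₀ hr, one_mul]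
      linarith
    · have hc : 0 < 1 - 2 * ε / r := by rw [sub_pos, div_lt_one hr]; exact h
      have h1 := geodesicDist_le_of_infDist_le hM hr hreach h hKM hx hy
      have hmin : ENNReal.ofReal ((1 - 2 * ε / r) * dM) ≤
          min (geodesicDist K x y) (ENNReal.ofReal Δ) := by
        refine le_min ?_ ?_
        · rw [ENNReal.ofReal_mul hc.le, hdMe]
          calc _ ≤ ENNReal.ofReal (1 - 2 * ε / r) *
                (ENNReal.ofReal (1 - 2 * ε / r)⁻¹ * geodesicDist K x y) := by gcongr
            _ = geodesicDist K x y := by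
                rw [← mul_assoc, ← ENNReal.ofReal_mul hc.le, mul_inv_cancel₀ hc.ne',
                  ENNReal.ofReal_one, one_mul]
        · refine le_trans ?_ (hdiam x hx y hy)
          rw [← hdMe]
          apply ENNReal.ofReal_le_ofReal
          have : 0 ≤ 2 * ε / r := by positivity
          exact mul_le_of_le_one_left hpos.le (by linarith)
      rw [le_div_iff₀ hpos]
      have h2 := ENNReal.toReal_mono
        (ne_top_of_le_ne_top ENNReal.ofReal_ne_top (min_le_right _ _)) hmin
      rwa [ENNReal.toReal_ofReal (by positivity)] at h2
  have : 0 ≤ 2 * ε / r := by positivity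
  rw [abs_le]
  constructor <;> linarith

theorem outerExpectation_le {Ω : Type*} [MeasurableSpace Ω] (μ : Measure Ω) {f : Ω → ℝ≥0∞}
    {A : Set Ω} {a b : ℝ≥0∞} (hA : ∀ ω ∈ A, f ω ≤ a) (hAc : ∀ ω ∈ Aᶜ, f ω ≤ b) :
    outerExpectation μ f ≤ a * μ A + b * μ Aᶜ := by
  -- `A` need not be measurable: use measurable hulls of `A` and of its complement
  let g : Ω → ℝ≥0∞ := fun ω => (toMeasurable μ A).indicator (fun _ => a) ω +
    (toMeasurable μ Aᶜ).indicator (fun _ => b) ω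
  have hmA := measurableSet_toMeasurable μ A
  have hmAc := measurableSet_toMeasurable μ Aᶜ
  have hg : Measurable g :=
    (measurable_const.indicator hmA).add (measurable_const.indicator hmAc)
  refine (iInf₂_le_of_le g hg (iInf_le_of_le (fun ω => ?_) le_rfl)).trans (le_of_eq ?_)
  · by_cases h : ω ∈ A
    · refine (hA ω h).trans ?_
      simp only [g, indicator_of_mem (subset_toMeasurable μ A h)]
      exact le_self_add
    · refine (hAc ω h).trans ?_
      simp only [g, indicator_of_mem (subset_toMeasurable μ Aᶜ h)]
      exact le_add_self
  · simp only [g]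
    rw [lintegral_add_left (measurable_const.indicator hmA), lintegral_indicator_const hmA,
      lintegral_indicator_const hmAc, measure_toMeasurable, measure_toMeasurable]

end PlugIn

end MetricLearning

open MetricLearning in
theorem mainTheorem5 (D d k : ℕ) (hd : 1 ≤ d) (hdD : d < D) (hk : 2 ≤ k)
    (rmin : ℝ) (hr : 0 < rmin) (L : ℕ → ℝ) (hL : ∀ j ∈ Finset.Icc 2 k, 0 < L j)
    (fmin fmax : ℝ) (hfmin : 0 < fmin) (hf : fmin ≤ fmax) :
    (∀ P : Measure (Amb D), IsModelDistribution d k rmin L fmin fmax P →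
      ∀ x ∈ P.support, ∀ y ∈ P.support,
        geodesicDist P.support x y ≤ ENNReal.ofReal (dMax d rmin fmin)) ∧
    (∀ (Δ : ℝ), dMax d rmin fmin ≤ Δ →
      ∀ (n : ℕ) (Mhat : (Fin n → Amb D) → Set (Amb D)) (ε : ℝ), 0 < ε →
      ∀ P : Measure (Amb D), IsModelDistribution d k rmin L fmin fmax P →
        outerExpectation (Measure.pi fun _ : Fin n => P)
            (fun X => lossInf P.support (plugInDist (Mhat X) ε Δ)) ≤
          ENNReal.ofReal (2 * ε / rmin) *
              (Measure.pi fun _ : Fin n => P) (preciseEvent Mhat P.support ε) +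
            ENNReal.ofReal (1 + Δ / ε) *
              (Measure.pi fun _ : Fin n => P) (preciseEvent Mhat P.support ε)ᶜ) := by
  refine ⟨fun P hP x hx y hy => hP.geodesicDist_le hk hr hfmin hx hy,
    fun Δ hΔ n Mhat ε hε P hP => ?_⟩
  have hdiam : ∀ x ∈ P.support, ∀ y ∈ P.support,
      geodesicDist P.support x y ≤ ENNReal.ofReal Δ := fun x hx y hy =>
    (hP.geodesicDist_le hk hr hfmin hx hy).trans (ENNReal.ofReal_le_ofReal hΔ)
  exact outerExpectation_le _
    (fun X hX => lossInf_plugInDist_le_of_hausdorffEDist_le hP.support.isCompact hr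
      hP.support.le_reach hε hdiam hX)
    (fun X _ => lossInf_plugInDist_le hε hdiam)
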